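/- Let $M^3$ be a smooth $3$-dimensional Riemannian manifold with metric $\langle\cdot,\cdot\rangle$, Levi-Civita connection $\nabla$ and curvature tensor $R^M(X,Y)Z=\nabla_X\nabla_YZ-\nabla_Y\nabla_XZ-\nabla_{[X,Y]}Z$. Let $\gamma:J\to M^3$ be a smooth curve parametrized by arc length on an open interval $J\subset\mathbb R$, with unit tangent $T=\gamma'$ and curvature $\kappa=\lVert\nabla_TT\rVert$. The curve $\gamma$ is called triharmonic if $$\nabla_T^5T+R^M(\nabla_T^3T,T)T-R^M(\nabla_T^2T,\nabla_TT)T=0,$$ and proper triharmonic if moreover it is not harmonic, that is, if $\nabla_TT$ does not vanish identically on $J$. A Frenet frame along $\gamma$ with torsion $\tau:J\to\mathbb R$ is a smooth orthonormal frame $\{T,N,B\}$ along $\gamma$ such that $$\nabla_TT=\kappa N,\qquad \nabla_TN=-\kappa T+\tau B,\qquad \nabla_TB=-\tau N,$$ and $\gamma$ is called a Frenet helix if it has a Frenet frame for which $\kappa$ and $\tau$ are both constant. Suppose that $\gamma$ is proper triharmonic and has constant curvature $\kappa=\kappa_0$. Then $\kappa_0\neq0$ and $\gamma$ is a Frenet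 helix. Moreover, for every Frenet frame $\{T,N,B\}$ along $\gamma$ the torsion is a constant $\tau_0$, and along $\gamma$ $$(\kappa_0^2+\tau_0^2)^2-(2\kappa_0^2+\tau_0^2)\,\langle R^M(N,T)T,N\rangle-\kappa_0\tau_0\,\langle R^M(B,N)T,N\rangle=0,$$ $$(2\kappa_0^2+\tau_0^2)\,\langle R^M(N,T)T,B\rangle+\kappa_0\tau_0\,\langle R^M(B,N)T,B\rangle=0.$$ -/

import Mathlib

open scoped Manifold ContDiff Bundle

noncomputable section

namespace TriharmonicCurve

section Coordinates

/-! Riemannian geometry of an open set of a vector space `E`, the metric being a function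
`G : E → E →L[ℝ] E →L[ℝ] ℝ`. -/

variable {E : Type*} [NormedAddCommGroup E] [NormedSpace ℝ E]

/-- The Christoffel symbol of the first kind `Γ_x(v, w)`, as the linear form
`z ↦ (1/2) (∂_v g(w, z) + ∂_w g(v, z) - ∂_z g(v, w))`. -/
def christoffelFirst (G : E → E →L[ℝ] E →L[ℝ] ℝ) (x v w : E) : E →L[ℝ] ℝ :=
  (1 / 2 : ℝ) • (fderiv ℝ G x v w + fderiv ℝ G x w v - ((fderiv ℝ G x).flip v).flip w)

/-- The Christoffel symbol of the second kind `Γ_x(v, w) = ∑ Γ^k_{ij} vⁱ wʲ ∂_k`: the vector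
obtained from `christoffelFirst G x v w` by raising the index with the metric `G x`. -/
def christoffel (G : E → E →L[ℝ] E →L[ℝ] ℝ) (x v w : E) : E :=
  (G x).inverse (christoffelFirst G x v w)

/-- The curvature tensor `R(u, v) w = ∇_u ∇_v w - ∇_v ∇_u w` in coordinates, where the vectors
`u`, `v`, `w` are extended to constant vector fields. -/
def coordCurvature (G : E → E →L[ℝ] E →L[ℝ] ℝ) (x u v w : E) : E :=
  fderiv ℝ (fun y => christoffel G y v w) x u - fderiv ℝ (fun y => christoffel G y u w) x v
    + christoffel G x u (christoffel G x v w) - christoffel G x v (christoffel G x u w)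

end Coordinates

section Manifold

variable {E : Type*} [NormedAddCommGroup E] [NormedSpace ℝ E]
  {M : Type*} [TopologicalSpace M] [ChartedSpace E M]

/-- The differential at `q` of the preferred chart around `p`. -/
def toCoord (p q : M) : TangentSpace 𝓘(ℝ, E) q →L[ℝ] E :=
  mfderiv 𝓘(ℝ, E) 𝓘(ℝ, E) (extChartAt 𝓘(ℝ, E) p) q

/-- The differential at `y` of the inverse of the preferred chart around `p`. -/
def ofCoord (p : M) (y : E) :
    E →L[ℝ] TangentSpace 𝓘(ℝ, E) ((extChartAt 𝓘(ℝ, E) p).symm y) :=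
  mfderiv 𝓘(ℝ, E) 𝓘(ℝ, E) (extChartAt 𝓘(ℝ, E) p).symm y

/-- The tangent vector at `p` whose components in the preferred chart around `p` are `v`. -/
def ofCoordSelf (p : M) (v : E) : TangentSpace 𝓘(ℝ, E) p :=
  mfderiv 𝓘(ℝ, E) 𝓘(ℝ, E) (extChartAt 𝓘(ℝ, E) p).symm (extChartAt 𝓘(ℝ, E) p p) v

/-- The velocity `T = γ'`. -/
def velocity (γ : ℝ → M) (t : ℝ) : TangentSpace 𝓘(ℝ, E) (γ t) :=
  mfderiv 𝓘(ℝ, ℝ) 𝓘(ℝ, E) γ t (1 : ℝ)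

/-- `V` is a smooth vector field along `γ` on `J`. -/
def IsSmoothAlong [IsManifold 𝓘(ℝ, E) ∞ M] (γ : ℝ → M) (J : Set ℝ) (V : ∀ t, TangentSpace 𝓘(ℝ, E) (γ t)) : Prop :=
  ContMDiffOn 𝓘(ℝ, ℝ) 𝓘(ℝ, E).tangent ∞ (fun t => (⟨γ t, V t⟩ : TangentBundle 𝓘(ℝ, E) M)) J

variable [Bundle.RiemannianBundle (fun x : M => TangentSpace 𝓘(ℝ, E) x)]

/-- The metric of `M` in the preferred chart around `p`. -/
def chartMetric (p : M) (y : E) : E →L[ℝ] E →L[ℝ] ℝ :=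
  (innerSL ℝ (E := TangentSpace 𝓘(ℝ, E) ((extChartAt 𝓘(ℝ, E) p).symm y))).bilinearComp
    (ofCoord p y) (ofCoord p y)

/-- The Riemannian curvature tensor `R(u, v) w`, with the sign convention
`R(X, Y) Z = ∇_X ∇_Y Z - ∇_Y ∇_X Z - ∇_[X, Y] Z`. -/
def curvatureTensor (p : M) (u v w : TangentSpace 𝓘(ℝ, E) p) : TangentSpace 𝓘(ℝ, E) p :=
  ofCoordSelf p (coordCurvature (chartMetric p) (extChartAt 𝓘(ℝ, E) p p)
    (toCoord p p u) (toCoord p p v) (toCoord p p w))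

/-- The Levi-Civita covariant derivative `∇_T V` of a vector field `V` along the curve `γ`.
In coordinates it is `dV^k/dt + Γ^k_{ij} (γⁱ)' V^j`; at time `t` it is computed in the preferred
chart around `γ t`. -/
def covDeriv (γ : ℝ → M) (V : ∀ t, TangentSpace 𝓘(ℝ, E) (γ t)) (t : ℝ) :
    TangentSpace 𝓘(ℝ, E) (γ t) :=
  ofCoordSelf (γ t)
    (deriv (fun s => toCoord (γ t) (γ s) (V s)) t
      + christoffel (chartMetric (γ t)) (extChartAt 𝓘(ℝ, E) (γ t) (γ t))
          (toCoord (γ t) (γ t) (velocity γ t)) (toCoord (γ t) (γ t) (V t)))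

/-- The iterated covariant derivative `∇_T^k T` of the velocity. -/
def covDerivIter (γ : ℝ → M) (k : ℕ) : ∀ t, TangentSpace 𝓘(ℝ, E) (γ t) :=
  (covDeriv γ)^[k] (velocity γ)

/-- `γ` is a smooth curve parametrized by arc length on `J`. -/
structure IsArcLengthCurve (γ : ℝ → M) (J : Set ℝ) : Prop where
  smooth : ContMDiffOn 𝓘(ℝ, ℝ) 𝓘(ℝ, E) ∞ γ J
  unit_speed : ∀ t ∈ J, ‖(velocity γ t : TangentSpace 𝓘(ℝ, E) (γ t))‖ = 1

variable (E) in
/-- Harmonic curves (geodesics): `∇_T T = 0`. -/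
def IsHarmonic (γ : ℝ → M) (J : Set ℝ) : Prop :=
  ∀ t ∈ J, (covDerivIter γ 1 t : TangentSpace 𝓘(ℝ, E) (γ t)) = 0

variable (E) in
/-- Triharmonic curves: arc length parametrized curves with
`∇_T^5 T + R(∇_T^3 T, T) T - R(∇_T^2 T, ∇_T T) T = 0`. -/
structure IsTriharmonic (γ : ℝ → M) (J : Set ℝ) : Prop where
  arcLength : IsArcLengthCurve (E := E) γ J
  tension_eq_zero : ∀ t ∈ J,
    (covDerivIter γ 5 t : TangentSpace 𝓘(ℝ, E) (γ t))
      + curvatureTensor (γ t) (covDerivIter γ 3 t) (velocity γ t) (velocity γ t)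
      - curvatureTensor (γ t) (covDerivIter γ 2 t) (covDerivIter γ 1 t) (velocity γ t) = 0

variable (E) in
/-- The curvature `κ = ‖∇_T T‖` of an arc length parametrized curve. -/
def curvature (γ : ℝ → M) (t : ℝ) : ℝ :=
  ‖(covDerivIter γ 1 t : TangentSpace 𝓘(ℝ, E) (γ t))‖

/-- `{T, N, B}` is a Frenet frame along `γ`, with curvature `κ = ‖∇_T T‖` and torsion `τ`. -/
structure IsFrenetFrame [IsManifold 𝓘(ℝ, E) ∞ M] (γ : ℝ → M) (J : Set ℝ) (τ : ℝ → ℝ)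
    (N B : ∀ t, TangentSpace 𝓘(ℝ, E) (γ t)) : Prop where
  smooth_normal : IsSmoothAlong γ J N
  smooth_binormal : IsSmoothAlong γ J B
  orthonormal : ∀ t ∈ J, Orthonormal ℝ ![velocity γ t, N t, B t]
  deriv_tangent : ∀ t ∈ J, covDeriv γ (velocity γ) t = curvature E γ t • N t
  deriv_normal : ∀ t ∈ J,
    covDeriv γ N t = -(curvature E γ t) • velocity γ t + τ t • B t
  deriv_binormal : ∀ t ∈ J, covDeriv γ B t = -(τ t) • N t

variable (E) in
/-- Frenet helices: curves with a Frenet frame whose curvature and torsion are both constant. -/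
def IsFrenetHelix [IsManifold 𝓘(ℝ, E) ∞ M] (γ : ℝ → M) (J : Set ℝ) : Prop :=
  ∃ (κ₀ τ₀ : ℝ) (N B : ∀ t, TangentSpace 𝓘(ℝ, E) (γ t)),
    (∀ t ∈ J, curvature E γ t = κ₀) ∧ IsFrenetFrame γ J (fun _ => τ₀) N B

end Manifold

end TriharmonicCurve

end

/-! Write `T_k` for `∇_T^k T`. Pairing the triharmonic equation with `T` removes both curvature
terms, because `R(u, v)` is skew, and leaves `⟨T_5, T⟩ = 0`. If `κ` is constant, repeated
differentiation of `⟨T, T⟩ = 1` and `⟨T_1, T_1⟩ = κ₀²` gives, with `f = ‖T_2‖²`, that `⟨T_1, T_3⟩ =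
-f` and `⟨T, T_4⟩ = f`. Differentiating these once more yields `⟨T_1, T_4⟩ = -(3/2) f'` and `⟨T_1,
T_4⟩ = f'`, so `f' = 0` (`IsTriharmonic.norm_covDerivIter_two_const`). In a Frenet frame `f = κ₀⁴ +
κ₀² τ²`, so `τ²` is constant, and by continuity so is `τ` (`IsTriharmonic.torsion_const`).

Then `T_3 = -(κ₀² + τ₀²) T_1` and `T_5 = (κ₀² + τ₀²)² T_1`. The equation becomes algebraic, and its
`N` and `B` components are the two claimed identities (`IsTriharmonic.frenet_equations`).

A Frenet frame exists because `κ₀ ≠ 0`: take `N = κ₀⁻¹ T_1` and let `B` be a unit field orthogonal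
to `T` and `N`. In dimension three `B` is unique up to sign, and signs can be matched along an
interval, so no orientation of `M` is needed (`exists_isFrenetFrame`).

Since `∇` and `R` are defined through charts, three facts come beforehand: `∇_T` is independent of
the chart (`toCoord_covDeriv`), it is compatible with the metric
(`IsSmoothAlongAt.hasDerivAt_inner`), and `R(u, v)` is skew (`inner_curvatureTensor_self`). -/

set_option linter.unusedSectionVars false

noncomputable section

namespace TriharmonicCurve

open Filter Topology

/-! Shortcuts for instance search. -/

local instance {E : Type*} [NormedAddCommGroup E] [NormedSpace ℝ E] :
    NormedAddCommGroup (E →L[ℝ] ℝ) :=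
  ContinuousLinearMap.toNormedAddCommGroup

local instance {E : Type*} [NormedAddCommGroup E] [NormedSpace ℝ E] :
    NormedSpace ℝ (E →L[ℝ] ℝ) :=
  ContinuousLinearMap.toNormedSpace

local instance {E : Type*} [NormedAddCommGroup E] [NormedSpace ℝ E] :
    NormedAddCommGroup (E →L[ℝ] E →L[ℝ] ℝ) :=
  ContinuousLinearMap.toNormedAddCommGroup

local instance {E : Type*} [NormedAddCommGroup E] [NormedSpace ℝ E] :
    NormedSpace ℝ (E →L[ℝ] E →L[ℝ] ℝ) :=
  ContinuousLinearMap.toNormedSpace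

local instance {E : Type*} [NormedAddCommGroup E] [NormedSpace ℝ E] :
    NormedAddCommGroup (E →L[ℝ] E →L[ℝ] E →L[ℝ] ℝ) :=
  ContinuousLinearMap.toNormedAddCommGroup

local instance {E : Type*} [NormedAddCommGroup E] [NormedSpace ℝ E] :
    NormedSpace ℝ (E →L[ℝ] E →L[ℝ] E →L[ℝ] ℝ) :=
  ContinuousLinearMap.toNormedSpace

/-! ### Christoffel symbols and curvature of a metric on an open subset of a vector space. -/

section CoordinateMetric

variable {E : Type*} [NormedAddCommGroup E] [NormedSpace ℝ E]

/-- `G` is a smooth Riemannian metric on the open set `U`. -/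
structure IsMetricOn (G : E → E →L[ℝ] E →L[ℝ] ℝ) (U : Set E) : Prop where
  isOpen : IsOpen U
  contDiffOn : ContDiffOn ℝ ∞ G U
  symm : ∀ x ∈ U, ∀ v w, G x v w = G x w v
  pos : ∀ x ∈ U, ∀ v, v ≠ 0 → 0 < G x v v

variable {G : E → E →L[ℝ] E →L[ℝ] ℝ} {U : Set E} {x : E}

namespace IsMetricOn

lemma contDiffAt (h : IsMetricOn G U) (hx : x ∈ U) : ContDiffAt ℝ ∞ G x :=
  h.contDiffOn.contDiffAt (h.isOpen.mem_nhds hx)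

lemma differentiableAt (h : IsMetricOn G U) (hx : x ∈ U) : DifferentiableAt ℝ G x :=
  (h.contDiffAt hx).differentiableAt (by simp)

lemma contDiffAt_fderiv (h : IsMetricOn G U) (hx : x ∈ U) : ContDiffAt ℝ ∞ (fderiv ℝ G) x :=
  (h.contDiffAt hx).fderiv_right (by simp)

lemma fderiv_symm (h : IsMetricOn G U) (hx : x ∈ U) (u v w : E) :
    fderiv ℝ G x u v w = fderiv ℝ G x u w v := by
  have hG := (h.differentiableAt hx).hasFDerivAt
  have h1 := (hG.clm_apply (hasFDerivAt_const v x)).clm_apply (hasFDerivAt_const w x)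
  have h2 := (hG.clm_apply (hasFDerivAt_const w x)).clm_apply (hasFDerivAt_const v x)
  have h3 := h1.congr_of_eventuallyEq (f₁ := fun y => G y w v)
    (by filter_upwards [h.isOpen.mem_nhds hx] with y hy using h.symm y hy w v)
  simpa using DFunLike.congr_fun (h3.unique h2) u

variable [FiniteDimensional ℝ E]

/-- Positivity makes `G x` injective, and `E` and its dual have equal dimension. Without this, the
`inverse` in `christoffel` could be its default value `0`. -/
lemma isInvertible (h : IsMetricOn G U) (hx : x ∈ U) : (G x).IsInvertible := by
  have hinj : Function.Injective (G x) := by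
    refine (injective_iff_map_eq_zero _).2 fun v hv => ?_
    by_contra hne
    exact (h.pos x hx v hne).ne' (by rw [hv]; rfl)
  have hfr : Module.finrank ℝ E = Module.finrank ℝ (E →L[ℝ] ℝ) := by
    rw [← (LinearMap.toContinuousLinearMap (𝕜 := ℝ) (E := E) (F' := ℝ)).finrank_eq]
    exact (Subspace.dual_finrank_eq (K := ℝ) (V := E)).symm
  refine ⟨(LinearEquiv.ofInjectiveOfFinrankEq (G x : E →ₗ[ℝ] _) hinj
    hfr).toContinuousLinearEquiv, ?_⟩
  ext v w
  rfl

lemma apply_christoffel (h : IsMetricOn G U) (hx : x ∈ U) (v w z : E) :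
    G x (christoffel G x v w) z = christoffelFirst G x v w z := by
  obtain ⟨e, he⟩ := h.isInvertible hx
  simp [christoffel, ← he]

lemma ext_of_apply (h : IsMetricOn G U) (hx : x ∈ U) {v w : E} (hvw : ∀ z, G x v z = G x w z) :
    v = w := by
  obtain ⟨e, he⟩ := h.isInvertible hx
  refine e.injective ?_
  have : (e : E →L[ℝ] E →L[ℝ] ℝ) v = (e : E →L[ℝ] E →L[ℝ] ℝ) w := by
    rw [he]; ext z; exact hvw z
  simpa using this

/-- The Christoffel symbols are compatible with the metric. -/
lemma christoffel_compatible (h : IsMetricOn G U) (hx : x ∈ U) (u v w : E) :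
    G x (christoffel G x u v) w + G x v (christoffel G x u w) = fderiv ℝ G x u v w := by
  rw [h.symm x hx v, h.apply_christoffel hx, h.apply_christoffel hx]
  simp only [christoffelFirst, smul_apply, sub_apply,
    add_apply, ContinuousLinearMap.flip_apply, smul_eq_mul]
  linear_combination (-1 / 2 : ℝ) * h.fderiv_symm hx u v w

end IsMetricOn

/-- No assumption on `G` is needed: `christoffelFirst` is bilinear in `v`, `w`, and `inverse` is a
linear map even at its default value. -/
lemma christoffel_add_left (G : E → E →L[ℝ] E →L[ℝ] ℝ) (x v v' w : E) :
    christoffel G x (v + v') w = christoffel G x v w + christoffel G x v' w := by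
  rw [christoffel, christoffel, christoffel, ← map_add]
  congr 1
  ext z
  simp [christoffelFirst]
  ring

lemma christoffel_add_right (G : E → E →L[ℝ] E →L[ℝ] ℝ) (x v w w' : E) :
    christoffel G x v (w + w') = christoffel G x v w + christoffel G x v w' := by
  rw [christoffel, christoffel, christoffel, ← map_add]
  congr 1
  ext z
  simp [christoffelFirst]
  ring

lemma christoffel_smul_left (G : E → E →L[ℝ] E →L[ℝ] ℝ) (x : E) (a : ℝ) (v w : E) :
    christoffel G x (a • v) w = a • christoffel G x v w := by
  rw [christoffel, christoffel, ← map_smul]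
  congr 1
  ext z
  simp [christoffelFirst]
  ring

lemma christoffel_smul_right (G : E → E →L[ℝ] E →L[ℝ] ℝ) (x : E) (a : ℝ) (v w : E) :
    christoffel G x v (a • w) = a • christoffel G x v w := by
  rw [christoffel, christoffel, ← map_smul]
  congr 1
  ext z
  simp [christoffelFirst]
  ring

/-- The parameter space `D` is arbitrary so that the lemma serves both constant fields on `E` and
fields along a curve. -/
lemma IsMetricOn.contDiffAt_christoffel [FiniteDimensional ℝ E] {D : Type*} [NormedAddCommGroup D]
    [NormedSpace ℝ D] (h : IsMetricOn G U) {f v w : D → E} {d : D} (hd : f d ∈ U)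
    (hf : ContDiffAt ℝ ∞ f d) (hv : ContDiffAt ℝ ∞ v d) (hw : ContDiffAt ℝ ∞ w d) :
    ContDiffAt ℝ ∞ (fun s => christoffel G (f s) (v s) (w s)) d := by
  have : CompleteSpace E := FiniteDimensional.complete ℝ E
  have hG : ContDiffAt ℝ ∞ (fun s => G (f s)) d := (h.contDiffAt hd).comp d hf
  have hDG : ContDiffAt ℝ ∞ (fun s => fderiv ℝ G (f s)) d := (h.contDiffAt_fderiv hd).comp d hf
  have hinv : ContDiffAt ℝ ∞ (fun s => (G (f s)).inverse) d :=
    ContDiffAt.comp (g := ContinuousLinearMap.inverse) d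
      (h.isInvertible hd).contDiffAt_map_inverse hG
  refine hinv.clm_apply ?_
  refine ContDiffAt.const_smul (1 / 2 : ℝ) ((((hDG.clm_apply hv).clm_apply hw).add
    ((hDG.clm_apply hw).clm_apply hv)).sub ?_)
  have h1 : ContDiffAt ℝ ∞ (fun s => (fderiv ℝ G (f s)).flip (v s)) d :=
    ((ContinuousLinearMap.flipₗᵢ ℝ E E (E →L[ℝ] ℝ)).contDiff.contDiffAt.comp d hDG).clm_apply hv
  exact ((ContinuousLinearMap.flipₗᵢ ℝ E E ℝ).contDiff.contDiffAt.comp d h1).clm_apply hw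

/-- The transformation law of the Christoffel symbols under a change of coordinates `φ`. -/
lemma IsMetricOn.christoffel_change [FiniteDimensional ℝ E] {G' : E → E →L[ℝ] E →L[ℝ] ℝ}
    {U' : Set E} {φ : E → E} (h : IsMetricOn G U) (h' : IsMetricOn G' U') (hx : x ∈ U)
    (hx' : φ x ∈ U') (hφ : ContDiffAt ℝ ∞ φ x) (hsurj : Function.Surjective (fderiv ℝ φ x))
    (hG : ∀ᶠ y in 𝓝 x, ∀ v w, G y v w = G' (φ y) (fderiv ℝ φ y v) (fderiv ℝ φ y w)) (v w : E) :
    fderiv ℝ φ x (christoffel G x v w) =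
      fderiv ℝ (fderiv ℝ φ) x v w
        + christoffel G' (φ x) (fderiv ℝ φ x v) (fderiv ℝ φ x w) := by
  have hsymm : ∀ a b, fderiv ℝ (fderiv ℝ φ) x a b = fderiv ℝ (fderiv ℝ φ) x b a := fun a b =>
    (hφ.isSymmSndFDerivAt (by simpa using! ENat.LEInfty.out)).eq a b
  have hφ1 : HasFDerivAt φ (fderiv ℝ φ x) x := (hφ.differentiableAt (by simp)).hasFDerivAt
  have hφ2 : HasFDerivAt (fderiv ℝ φ) (fderiv ℝ (fderiv ℝ φ) x) x :=
    ((hφ.fderiv_right (m := ∞) (by simp)).differentiableAt (by simp)).hasFDerivAt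
  -- Differentiate `G = φ^* G'`. In the combination defining `christoffelFirst`, symmetry of `D²φ`
  -- and `G'` cancels all second-order terms except `G' (D²φ(v, w), Dφ z)`.
  have key : ∀ a b c, fderiv ℝ G x a b c =
      fderiv ℝ G' (φ x) (fderiv ℝ φ x a) (fderiv ℝ φ x b) (fderiv ℝ φ x c)
        + G' (φ x) (fderiv ℝ (fderiv ℝ φ) x a b) (fderiv ℝ φ x c)
        + G' (φ x) (fderiv ℝ φ x b) (fderiv ℝ (fderiv ℝ φ) x a c) := by
    intro a b c
    have h1 := ((h.differentiableAt hx).hasFDerivAt.clm_apply (hasFDerivAt_const b x)).clm_apply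
      (hasFDerivAt_const c x)
    have h2 := (((h'.differentiableAt hx').hasFDerivAt.comp x hφ1).clm_apply
      (hφ2.clm_apply (hasFDerivAt_const b x))).clm_apply
      (hφ2.clm_apply (hasFDerivAt_const c x))
    have h3 := h1.congr_of_eventuallyEq
      (f₁ := fun y => G' (φ y) (fderiv ℝ φ y b) (fderiv ℝ φ y c))
      (by filter_upwards [hG] with y hy using (hy b c).symm)
    have := DFunLike.congr_fun (h3.unique h2) a
    simp at this
    linear_combination this
  refine h'.ext_of_apply hx' fun z => ?_
  obtain ⟨z, rfl⟩ := hsurj z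
  rw [← hG.self_of_nhds, h.apply_christoffel hx, map_add, add_apply,
    h'.apply_christoffel hx']
  simp only [christoffelFirst, smul_apply, sub_apply,
    add_apply, ContinuousLinearMap.flip_apply, smul_eq_mul, key]
  rw [hsymm w v, hsymm z v, hsymm z w, h'.symm _ hx' (fderiv ℝ φ x w),
    h'.symm _ hx' (fderiv ℝ φ x v)]
  ring

lemma coordCurvature_swap (G : E → E →L[ℝ] E →L[ℝ] ℝ) (x u v w : E) :
    coordCurvature G x u v w = -coordCurvature G x v u w := by
  simp only [coordCurvature]
  abel

namespace IsMetricOn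

variable [FiniteDimensional ℝ E]

lemma differentiableAt_christoffel (h : IsMetricOn G U) (hx : x ∈ U) (v w : E) :
    DifferentiableAt ℝ (fun y => christoffel G y v w) x :=
  (h.contDiffAt_christoffel hx contDiffAt_id contDiffAt_const contDiffAt_const).differentiableAt
    (by simp)

lemma coordCurvature_add_left (h : IsMetricOn G U) (hx : x ∈ U) (u u' v w : E) :
    coordCurvature G x (u + u') v w = coordCurvature G x u v w + coordCurvature G x u' v w := by
  simp only [coordCurvature, christoffel_add_left, christoffel_add_right, map_add]
  rw [fderiv_fun_add (h.differentiableAt_christoffel hx _ _)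
    (h.differentiableAt_christoffel hx _ _), add_apply]
  abel

lemma coordCurvature_smul_left (h : IsMetricOn G U) (hx : x ∈ U) (a : ℝ) (u v w : E) :
    coordCurvature G x (a • u) v w = a • coordCurvature G x u v w := by
  simp only [coordCurvature, christoffel_smul_left, christoffel_smul_right, map_smul]
  rw [fderiv_fun_const_smul (h.differentiableAt_christoffel hx _ _),
    smul_apply]
  simp only [smul_sub, smul_add]

/-- The curvature operator `R(u, v)` is skew-symmetric. -/
lemma apply_coordCurvature_self (h : IsMetricOn G U) (hx : x ∈ U) (u v w : E) :
    G x (coordCurvature G x u v w) w = 0 := by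
  have hG2 : ∀ a b, fderiv ℝ (fderiv ℝ G) x a b = fderiv ℝ (fderiv ℝ G) x b a := fun a b =>
    ((h.contDiffAt hx).isSymmSndFDerivAt (by simpa using! ENat.LEInfty.out)).eq a b
  -- Compatibility says `∂_b g(w, w) = 2 g(Γ(b, w), w)`; differentiate this along `a`. The left side
  -- is symmetric in `a`, `b`, and antisymmetrizing the right side produces `g(R(u, v) w, w)`.
  have key : ∀ a b, fderiv ℝ (fderiv ℝ G) x a b w w =
      2 * (fderiv ℝ G x a (christoffel G x b w) w
        + G x (fderiv ℝ (fun y => christoffel G y b w) x a) w) := by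
    intro a b
    have h1 := ((((h.contDiffAt_fderiv hx).differentiableAt (by simp)).hasFDerivAt.clm_apply
      (hasFDerivAt_const b x)).clm_apply (hasFDerivAt_const w x)).clm_apply (hasFDerivAt_const w x)
    have h2 := (((h.differentiableAt hx).hasFDerivAt.clm_apply
      (h.differentiableAt_christoffel hx b w).hasFDerivAt).clm_apply
      (hasFDerivAt_const w x)).const_mul 2
    have h3 := h2.congr_of_eventuallyEq (f₁ := fun y => fderiv ℝ G y b w w) (by
      filter_upwards [h.isOpen.mem_nhds hx] with y hy
      rw [← h.christoffel_compatible hy, h.symm y hy w]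
      ring)
    have := DFunLike.congr_fun (h1.unique h3) a
    simp at this
    linear_combination this
  have hk := (key u v).symm.trans ((by rw [hG2]) : _ = fderiv ℝ (fderiv ℝ G) x v u w w)
  rw [key, ← h.christoffel_compatible hx, ← h.christoffel_compatible hx] at hk
  simp only [coordCurvature, map_add, map_sub, add_apply,
    sub_apply]
  rw [h.symm x hx (christoffel G x u w)] at hk
  linear_combination hk / 2

end IsMetricOn

end CoordinateMetric

/-! ### Charts of `M`: components of vectors, changes of coordinates, and the metric. -/

section Charts

variable {E : Type*} [NormedAddCommGroup E] [NormedSpace ℝ E]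
  {M : Type*} [TopologicalSpace M] [ChartedSpace E M] [IsManifold 𝓘(ℝ, E) ∞ M]

variable {p q : M}

/-- Links chart differentials to the trivialization of the tangent bundle, so that smoothness into
the bundle can be tested on components. -/
lemma toCoord_eq_trivializationAt (hq : q ∈ (chartAt E p).source) (v : TangentSpace 𝓘(ℝ, E) q) :
    toCoord p q v = (trivializationAt E (TangentSpace 𝓘(ℝ, E)) p ⟨q, v⟩).2 := by
  rw [toCoord, ← TangentBundle.continuousLinearMapAt_trivializationAt hq,
    Bundle.Trivialization.continuousLinearMapAt_apply,
    Bundle.Trivialization.coe_linearMapAt_of_mem _ (by simpa using hq)]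

lemma ofCoord_toCoord {y : E} (hy : y ∈ (extChartAt 𝓘(ℝ, E) p).target)
    (v : TangentSpace 𝓘(ℝ, E) ((extChartAt 𝓘(ℝ, E) p).symm y)) :
    ofCoord p y (toCoord p _ v) = v := by
  have h := mfderivWithin_extChartAt_symm_comp_mfderiv_extChartAt hy
  simp only [modelWithCornersSelf_coe, Set.range_id, mfderivWithin_univ] at h
  exact DFunLike.congr_fun h v

lemma toCoord_ofCoord {y : E} (hy : y ∈ (extChartAt 𝓘(ℝ, E) p).target) (v : E) :
    toCoord p _ (ofCoord p y v) = v := by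
  have h := mfderiv_extChartAt_comp_mfderivWithin_extChartAt_symm hy
  simp only [modelWithCornersSelf_coe, Set.range_id, mfderivWithin_univ] at h
  exact DFunLike.congr_fun h v

lemma toCoord_ofCoordSelf (v : E) : toCoord p p (ofCoordSelf p v) = v := by
  have h := mfderiv_extChartAt_comp_mfderivWithin_extChartAt_symm' (I := 𝓘(ℝ, E))
    (mem_extChartAt_source (I := 𝓘(ℝ, E)) p)
  simp only [modelWithCornersSelf_coe, Set.range_id, mfderivWithin_univ] at h
  exact DFunLike.congr_fun h v

lemma toCoord_injective (hq : q ∈ (chartAt E p).source) :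
    Function.Injective (toCoord (E := E) p q) := by
  obtain ⟨e, he⟩ := isInvertible_mfderiv_extChartAt (I := 𝓘(ℝ, E)) (x := p) (y := q)
    (by simpa using hq)
  rw [toCoord, ← he]
  exact e.injective

lemma toCoord_surjective (hq : q ∈ (chartAt E p).source) :
    Function.Surjective (toCoord (E := E) p q) := by
  obtain ⟨e, he⟩ := isInvertible_mfderiv_extChartAt (I := 𝓘(ℝ, E)) (x := p) (y := q)
    (by simpa using hq)
  rw [toCoord, ← he]
  exact e.surjective

/-- The change of coordinates from the chart around `q` to the chart around `p`. -/
def coordChange (p q : M) : E → E :=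
  fun y => extChartAt 𝓘(ℝ, E) p ((extChartAt 𝓘(ℝ, E) q).symm y)

lemma contDiffAt_coordChange {r : M} (hp : r ∈ (chartAt E p).source)
    (hq : r ∈ (chartAt E q).source) :
    ContDiffAt ℝ ∞ (coordChange p q) (extChartAt 𝓘(ℝ, E) q r) := by
  rw [← contMDiffAt_iff_contDiffAt]
  have h1 : ContMDiffAt 𝓘(ℝ, E) 𝓘(ℝ, E) ∞ (extChartAt 𝓘(ℝ, E) q).symm
      (extChartAt 𝓘(ℝ, E) q r) :=
    (contMDiffOn_extChartAt_symm q).contMDiffAt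
      ((isOpen_extChartAt_target q).mem_nhds
        ((extChartAt 𝓘(ℝ, E) q).map_source (by simpa using hq)))
  refine ContMDiffAt.comp (g := extChartAt 𝓘(ℝ, E) p) _ ?_ h1
  rw [(extChartAt 𝓘(ℝ, E) q).left_inv (by simpa using hq)]
  exact contMDiffAt_extChartAt' hp

lemma fderiv_coordChange {r : M} (hp : r ∈ (chartAt E p).source)
    (hq : r ∈ (chartAt E q).source) (v : TangentSpace 𝓘(ℝ, E) r) :
    fderiv ℝ (coordChange p q) (extChartAt 𝓘(ℝ, E) q r) (toCoord q r v) = toCoord p r v := by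
  have h1 : MDifferentiableAt 𝓘(ℝ, E) 𝓘(ℝ, E) (coordChange p q) (extChartAt 𝓘(ℝ, E) q r) :=
    ((contDiffAt_coordChange hp hq).differentiableAt (by simp)).mdifferentiableAt
  have h2 := mfderiv_comp r h1 (mdifferentiableAt_extChartAt (I := 𝓘(ℝ, E)) hq)
  have h3 : coordChange p q ∘ extChartAt 𝓘(ℝ, E) q =ᶠ[𝓝 r] extChartAt 𝓘(ℝ, E) p := by
    filter_upwards [extChartAt_source_mem_nhds' (I := 𝓘(ℝ, E)) (x := q) (by simpa using hq)]
      with s hs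
    simp only [coordChange, Function.comp, (extChartAt 𝓘(ℝ, E) q).left_inv hs]
  rw [h3.mfderiv_eq, mfderiv_eq_fderiv] at h2
  exact (DFunLike.congr_fun h2 v).symm

/-- A coordinate vector field of a chart is smooth. -/
lemma contMDiffOn_ofCoord (p : M) (v : E) :
    ContMDiffOn 𝓘(ℝ, E) 𝓘(ℝ, E).tangent ∞
      (fun y => (⟨(extChartAt 𝓘(ℝ, E) p).symm y, ofCoord p y v⟩ : TangentBundle 𝓘(ℝ, E) M))
      (extChartAt 𝓘(ℝ, E) p).target := by
  have hs : ∀ y ∈ (extChartAt 𝓘(ℝ, E) p).target,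
      (extChartAt 𝓘(ℝ, E) p).symm y ∈ (chartAt E p).source := fun y hy => by
    simpa using (extChartAt 𝓘(ℝ, E) p).map_target hy
  refine (Bundle.Trivialization.contMDiffOn_iff
    (e := trivializationAt E (TangentSpace 𝓘(ℝ, E)) p) ?_).2
    ⟨contMDiffOn_extChartAt_symm p, ?_⟩
  · intro y hy
    simpa using hs y hy
  · refine (contMDiffOn_const (c := v)).congr fun y hy => ?_
    rw [← toCoord_eq_trivializationAt (hs y hy), toCoord_ofCoord hy]

variable [Bundle.RiemannianBundle (fun x : M => TangentSpace 𝓘(ℝ, E) x)]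

lemma chartMetric_toCoord (hq : q ∈ (chartAt E p).source) (v w : TangentSpace 𝓘(ℝ, E) q) :
    chartMetric p (extChartAt 𝓘(ℝ, E) p q) (toCoord p q v) (toCoord p q w) = inner ℝ v w := by
  obtain ⟨y, hy, rfl⟩ : ∃ y ∈ (extChartAt 𝓘(ℝ, E) p).target, (extChartAt 𝓘(ℝ, E) p).symm y = q :=
    ⟨_, (extChartAt 𝓘(ℝ, E) p).map_source (by simpa using hq),
      (extChartAt 𝓘(ℝ, E) p).left_inv (by simpa using hq)⟩
  rw [(extChartAt 𝓘(ℝ, E) p).right_inv hy]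
  change inner ℝ (ofCoord p y _) (ofCoord p y _) = _
  rw [ofCoord_toCoord hy, ofCoord_toCoord hy]

variable [FiniteDimensional ℝ E]
  [IsContMDiffRiemannianBundle 𝓘(ℝ, E) ∞ E (fun x : M => TangentSpace 𝓘(ℝ, E) x)]

lemma isMetricOn_chartMetric (p : M) :
    IsMetricOn (E := E) (chartMetric p) (extChartAt 𝓘(ℝ, E) p).target where
  isOpen := isOpen_extChartAt_target p
  contDiffOn := by
    refine contDiffOn_clm_apply.2 fun v => contDiffOn_clm_apply.2 fun w => ?_
    rw [← contMDiffOn_iff_contDiffOn]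
    exact ContMDiffOn.inner_bundle (F := E) (E := fun x : M => TangentSpace 𝓘(ℝ, E) x)
      (b := (extChartAt 𝓘(ℝ, E) p).symm) (v := fun y => ofCoord p y v)
      (w := fun y => ofCoord p y w) (contMDiffOn_ofCoord p v) (contMDiffOn_ofCoord p w)
  symm x _ v w := real_inner_comm (ofCoord p x w) (ofCoord p x v)
  pos x hx v hv := by
    change 0 < inner ℝ (ofCoord p x v) (ofCoord p x v)
    refine real_inner_self_pos.2 fun h => hv ?_
    rw [← toCoord_ofCoord hx v, h, map_zero]

end Charts

/-! ### Smooth fields along a curve and their covariant derivative. -/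

section AlongCurve

variable {E : Type*} [NormedAddCommGroup E] [NormedSpace ℝ E]
  {M : Type*} [TopologicalSpace M] [ChartedSpace E M] [IsManifold 𝓘(ℝ, E) ∞ M]

/-- `V` is a smooth vector field along `γ` near `t`. -/
def IsSmoothAlongAt (γ : ℝ → M) (V : ∀ t, TangentSpace 𝓘(ℝ, E) (γ t)) (t : ℝ) : Prop :=
  ContMDiffAt 𝓘(ℝ, ℝ) 𝓘(ℝ, E).tangent ∞ (fun s => (⟨γ s, V s⟩ : TangentBundle 𝓘(ℝ, E) M)) t

variable {γ : ℝ → M} {V W : ∀ t, TangentSpace 𝓘(ℝ, E) (γ t)} {t : ℝ} {p : M} {J : Set ℝ}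

lemma isSmoothAlong_iff (hJ : IsOpen J) :
    IsSmoothAlong γ J V ↔ ∀ t ∈ J, IsSmoothAlongAt γ V t :=
  forall₂_congr fun _ ht =>
    ⟨fun h => h.contMDiffAt (hJ.mem_nhds ht), fun h => ContMDiffAt.contMDiffWithinAt h⟩

lemma eventually_mem_source (hγ : ContinuousAt γ t) (ht : γ t ∈ (chartAt E p).source) :
    ∀ᶠ s in 𝓝 t, γ s ∈ (chartAt E p).source :=
  hγ.eventually_mem ((chartAt E p).open_source.mem_nhds ht)

lemma isSmoothAlongAt_iff (hγ : ContMDiffAt 𝓘(ℝ, ℝ) 𝓘(ℝ, E) ∞ γ t)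
    (ht : γ t ∈ (chartAt E p).source) :
    IsSmoothAlongAt γ V t ↔ ContDiffAt ℝ ∞ (fun s => toCoord p (γ s) (V s)) t := by
  rw [IsSmoothAlongAt, Bundle.Trivialization.contMDiffAt_iff
    (e := trivializationAt E (TangentSpace 𝓘(ℝ, E)) p) (by simpa using ht), and_iff_right hγ,
    ← contMDiffAt_iff_contDiffAt]
  refine Filter.EventuallyEq.contMDiffAt_iff ?_
  filter_upwards [eventually_mem_source hγ.continuousAt ht] with s hs
  exact (toCoord_eq_trivializationAt hs _).symm

lemma IsSmoothAlongAt.contMDiffAt (hV : IsSmoothAlongAt γ V t) :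
    ContMDiffAt 𝓘(ℝ, ℝ) 𝓘(ℝ, E) ∞ γ t :=
  (Bundle.contMDiffAt_totalSpace.1 hV).1

lemma IsSmoothAlongAt.contDiffAt (hV : IsSmoothAlongAt γ V t) (ht : γ t ∈ (chartAt E p).source) :
    ContDiffAt ℝ ∞ (fun s => toCoord p (γ s) (V s)) t :=
  (isSmoothAlongAt_iff hV.contMDiffAt ht).1 hV

lemma IsSmoothAlongAt.differentiableAt (hV : IsSmoothAlongAt γ V t)
    (ht : γ t ∈ (chartAt E p).source) :
    DifferentiableAt ℝ (fun s => toCoord p (γ s) (V s)) t :=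
  (hV.contDiffAt ht).differentiableAt (by simp)

lemma IsSmoothAlongAt.add (hV : IsSmoothAlongAt γ V t) (hW : IsSmoothAlongAt γ W t) :
    IsSmoothAlongAt γ (fun s => V s + W s) t := by
  have ht := mem_chart_source E (γ t)
  rw [isSmoothAlongAt_iff hV.contMDiffAt ht]
  simp only [map_add]
  exact (hV.contDiffAt ht).add (hW.contDiffAt ht)

lemma IsSmoothAlongAt.smul {f : ℝ → ℝ} (hf : ContDiffAt ℝ ∞ f t) (hV : IsSmoothAlongAt γ V t) :
    IsSmoothAlongAt γ (fun s => f s • V s) t := by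
  have ht := mem_chart_source E (γ t)
  rw [isSmoothAlongAt_iff hV.contMDiffAt ht]
  simp only [map_smul]
  exact hf.smul (hV.contDiffAt ht)

lemma IsSmoothAlongAt.congr (hV : IsSmoothAlongAt γ V t) (h : ∀ᶠ s in 𝓝 t, W s = V s) :
    IsSmoothAlongAt γ W t :=
  ContMDiffAt.congr_of_eventuallyEq hV (by filter_upwards [h] with s hs using by rw [hs])

lemma contDiffAt_extChartAt_comp (hγ : ContMDiffAt 𝓘(ℝ, ℝ) 𝓘(ℝ, E) ∞ γ t)
    (ht : γ t ∈ (chartAt E p).source) :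
    ContDiffAt ℝ ∞ (fun s => extChartAt 𝓘(ℝ, E) p (γ s)) t := by
  rw [← contMDiffAt_iff_contDiffAt]
  exact ContMDiffAt.comp (g := extChartAt 𝓘(ℝ, E) p) t (contMDiffAt_extChartAt' ht) hγ

lemma hasDerivAt_extChartAt_comp (hγ : ContMDiffAt 𝓘(ℝ, ℝ) 𝓘(ℝ, E) ∞ γ t)
    (ht : γ t ∈ (chartAt E p).source) :
    HasDerivAt (fun s => extChartAt 𝓘(ℝ, E) p (γ s)) (toCoord p (γ t) (velocity γ t)) t := by
  have h := mfderiv_comp t (mdifferentiableAt_extChartAt (I := 𝓘(ℝ, E)) ht)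
    (hγ.mdifferentiableAt (by simp))
  rw [mfderiv_eq_fderiv] at h
  have h2 := ((contDiffAt_extChartAt_comp hγ ht).differentiableAt (by simp)).hasDerivAt
  convert h2 using 1
  exact (DFunLike.congr_fun h (1 : ℝ)).symm

lemma isSmoothAlongAt_velocity (h : ∀ᶠ s in 𝓝 t, ContMDiffAt 𝓘(ℝ, ℝ) 𝓘(ℝ, E) ∞ γ s) :
    IsSmoothAlongAt (E := E) γ (velocity γ) t := by
  have hγ := h.self_of_nhds
  have ht := mem_chart_source E (γ t)
  rw [isSmoothAlongAt_iff hγ ht]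
  have h1 : ContDiffAt ℝ ∞ (deriv fun s => extChartAt 𝓘(ℝ, E) (γ t) (γ s)) t := by
    have := (contDiffAt_extChartAt_comp hγ ht).fderiv_right (m := ∞) (by simp)
    exact this.clm_apply contDiffAt_const
  refine h1.congr_of_eventuallyEq ?_
  filter_upwards [eventually_mem_source hγ.continuousAt ht,
    h] with s hs hγs
  exact (hasDerivAt_extChartAt_comp hγs hs).deriv.symm

variable [Bundle.RiemannianBundle (fun x : M => TangentSpace 𝓘(ℝ, E) x)]

lemma covDeriv_congr (h : ∀ᶠ s in 𝓝 t, V s = W s) : covDeriv γ V t = covDeriv γ W t := by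
  have h1 : (fun s => toCoord (γ t) (γ s) (V s)) =ᶠ[𝓝 t] fun s => toCoord (γ t) (γ s) (W s) := by
    filter_upwards [h] with s hs using by rw [hs]
  rw [covDeriv, covDeriv, h1.deriv_eq, h.self_of_nhds]

lemma covDeriv_add (hV : IsSmoothAlongAt γ V t) (hW : IsSmoothAlongAt γ W t) :
    covDeriv γ (fun s => V s + W s) t = covDeriv γ V t + covDeriv γ W t := by
  have ht := mem_chart_source E (γ t)
  refine toCoord_injective ht ?_
  simp only [covDeriv, map_add, toCoord_ofCoordSelf, christoffel_add_right]
  rw [deriv_fun_add (hV.differentiableAt ht) (hW.differentiableAt ht)]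
  abel

lemma covDeriv_smul {f : ℝ → ℝ} {f' : ℝ} (hf : HasDerivAt f f' t) (hV : IsSmoothAlongAt γ V t) :
    covDeriv γ (fun s => f s • V s) t = f' • V t + f t • covDeriv γ V t := by
  have ht := mem_chart_source E (γ t)
  refine toCoord_injective ht ?_
  simp only [covDeriv, map_add, map_smul, toCoord_ofCoordSelf, christoffel_smul_right]
  rw [(hf.fun_smul (hV.differentiableAt ht).hasDerivAt).deriv, smul_add]
  abel

lemma covDeriv_const_smul (a : ℝ) (hV : IsSmoothAlongAt γ V t) :
    covDeriv γ (fun s => a • V s) t = a • covDeriv γ V t := by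
  rw [covDeriv_smul (hasDerivAt_const t a) hV, zero_smul, zero_add]

variable [FiniteDimensional ℝ E]
  [IsContMDiffRiemannianBundle 𝓘(ℝ, E) ∞ E (fun x : M => TangentSpace 𝓘(ℝ, E) x)]

/-- The coordinate expression of the covariant derivative in an arbitrary preferred chart. -/
lemma toCoord_covDeriv (hV : IsSmoothAlongAt γ V t) (ht : γ t ∈ (chartAt E p).source) :
    toCoord p (γ t) (covDeriv γ V t) =
      deriv (fun s => toCoord p (γ s) (V s)) t
        + christoffel (chartMetric p) (extChartAt 𝓘(ℝ, E) p (γ t))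
            (toCoord p (γ t) (velocity γ t)) (toCoord p (γ t) (V t)) := by
  have hγ := hV.contMDiffAt
  set q := γ t with hq
  have hqq : γ t ∈ (chartAt E q).source := mem_chart_source E (γ t)
  have hx : extChartAt 𝓘(ℝ, E) q q ∈ (extChartAt 𝓘(ℝ, E) q).target :=
    mem_extChartAt_target q
  have hφx : coordChange p q (extChartAt 𝓘(ℝ, E) q q) = extChartAt 𝓘(ℝ, E) p q := by
    simp [coordChange]
  have hφ := contDiffAt_coordChange ht hqq
  have hsurj : Function.Surjective (fderiv ℝ (coordChange p q) (extChartAt 𝓘(ℝ, E) q q)) := by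
    intro z
    obtain ⟨v, rfl⟩ := toCoord_surjective ht z
    exact ⟨_, fderiv_coordChange ht hqq v⟩
  have hG : ∀ᶠ y in 𝓝 (extChartAt 𝓘(ℝ, E) q q), ∀ v w, chartMetric q y v w =
      chartMetric p (coordChange p q y) (fderiv ℝ (coordChange p q) y v)
        (fderiv ℝ (coordChange p q) y w) := by
    have hc : ContinuousAt (extChartAt 𝓘(ℝ, E) q).symm (extChartAt 𝓘(ℝ, E) q q) :=
      continuousAt_extChartAt_symm q
    filter_upwards [extChartAt_target_mem_nhds (I := 𝓘(ℝ, E)) q,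
      hc.eventually_mem ((chartAt E p).open_source.mem_nhds
        (by simpa using ht))] with y hy hyp v w
    have hyq : (extChartAt 𝓘(ℝ, E) q).symm y ∈ (chartAt E q).source := by
      simpa using (extChartAt 𝓘(ℝ, E) q).map_target hy
    obtain ⟨v, rfl⟩ := toCoord_surjective hyq v
    obtain ⟨w, rfl⟩ := toCoord_surjective hyq w
    have h1 := chartMetric_toCoord hyq v w
    have h2 := chartMetric_toCoord hyp v w
    rw [← fderiv_coordChange hyp hyq v, ← fderiv_coordChange hyp hyq w] at h2
    rw [(extChartAt 𝓘(ℝ, E) q).right_inv hy] at h1 h2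
    exact h1.trans h2.symm
  have hΓ := (isMetricOn_chartMetric q).christoffel_change (isMetricOn_chartMetric p) hx
    (by rw [hφx]; exact (extChartAt 𝓘(ℝ, E) p).map_source (by simpa using ht)) hφ hsurj hG
    (toCoord q q (velocity γ t)) (toCoord q q (V t))
  -- Differentiating the transformed components `Dφ(V)` produces an extra term `D²φ(γ', V)`; it is
  -- exactly the inhomogeneous term of the transformation law `hΓ`.
  have h1 := ((hφ.fderiv_right (m := ∞) (by simp)).differentiableAt
    (by simp)).hasFDerivAt.comp_hasDerivAt t (hasDerivAt_extChartAt_comp hγ hqq)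
  have h2 := h1.clm_apply (hV.differentiableAt hqq).hasDerivAt
  have h3 : (fun s => toCoord p (γ s) (V s)) =ᶠ[𝓝 t]
      fun s => fderiv ℝ (coordChange p q) (extChartAt 𝓘(ℝ, E) q (γ s)) (toCoord q (γ s) (V s)) := by
    filter_upwards [eventually_mem_source hγ.continuousAt ht,
      eventually_mem_source hγ.continuousAt hqq] with s hs hs'
    exact (fderiv_coordChange hs hs' (V s)).symm
  rw [(h2.congr_of_eventuallyEq h3).deriv, ← fderiv_coordChange ht hqq, covDeriv,
    toCoord_ofCoordSelf, map_add, hΓ, hφx]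
  rw [fderiv_coordChange ht hqq, fderiv_coordChange ht hqq]
  simp only [Function.comp]
  abel

lemma isSmoothAlongAt_covDeriv (h : ∀ᶠ s in 𝓝 t, IsSmoothAlongAt γ V s) :
    IsSmoothAlongAt γ (covDeriv γ V) t := by
  have hV := h.self_of_nhds
  have hγ := hV.contMDiffAt
  have ht := mem_chart_source E (γ t)
  rw [isSmoothAlongAt_iff hγ ht]
  have h1 : ContDiffAt ℝ ∞ (deriv fun s => toCoord (γ t) (γ s) (V s)) t :=
    ((hV.contDiffAt ht).fderiv_right (m := ∞) (by simp)).clm_apply contDiffAt_const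
  refine (h1.add ((isMetricOn_chartMetric (γ t)).contDiffAt_christoffel
    (mem_extChartAt_target (I := 𝓘(ℝ, E)) (γ t)) (contDiffAt_extChartAt_comp hγ ht)
    ((isSmoothAlongAt_velocity (h.mono fun _ hs => hs.contMDiffAt)).contDiffAt ht)
    (hV.contDiffAt ht))).congr_of_eventuallyEq ?_
  filter_upwards [eventually_mem_source hγ.continuousAt ht,
    h] with s hs hVs
  exact toCoord_covDeriv hVs hs

lemma IsSmoothAlongAt.contDiffAt_inner (hV : IsSmoothAlongAt γ V t)
    (hW : IsSmoothAlongAt γ W t) : ContDiffAt ℝ ∞ (fun s => inner ℝ (V s) (W s)) t := by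
  rw [← contMDiffAt_iff_contDiffAt]
  exact ContMDiffAt.inner_bundle (F := E) (E := fun x : M => TangentSpace 𝓘(ℝ, E) x) (b := γ)
    (v := V) (w := W) hV hW

/-- The covariant derivative along a curve is compatible with the metric. -/
lemma IsSmoothAlongAt.hasDerivAt_inner (hV : IsSmoothAlongAt γ V t)
    (hW : IsSmoothAlongAt γ W t) :
    HasDerivAt (fun s => inner ℝ (V s) (W s))
      (inner ℝ (covDeriv γ V t) (W t)
        + inner ℝ (V t) (covDeriv γ W t)) t := by
  have hγ := hV.contMDiffAt
  have ht := mem_chart_source E (γ t)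
  have hx := mem_extChartAt_target (I := 𝓘(ℝ, E)) (γ t)
  have hG := isMetricOn_chartMetric (E := E) (γ t)
  have h1 := (((hG.differentiableAt hx).hasFDerivAt.comp_hasDerivAt t
    (hasDerivAt_extChartAt_comp hγ ht)).clm_apply (hV.differentiableAt ht).hasDerivAt).clm_apply
    (hW.differentiableAt ht).hasDerivAt
  have h2 : (fun s => inner ℝ (V s) (W s)) =ᶠ[𝓝 t] fun s =>
      chartMetric (γ t) (extChartAt 𝓘(ℝ, E) (γ t) (γ s)) (toCoord (γ t) (γ s) (V s))
        (toCoord (γ t) (γ s) (W s)) := by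
    filter_upwards [eventually_mem_source hγ.continuousAt ht] with s hs
    exact (chartMetric_toCoord hs _ _).symm
  refine (h1.congr_of_eventuallyEq h2).congr_deriv ?_
  rw [← chartMetric_toCoord ht, ← chartMetric_toCoord ht, toCoord_covDeriv hV ht,
    toCoord_covDeriv hW ht]
  simp only [Function.comp, map_add, add_apply]
  rw [← hG.christoffel_compatible hx]
  ring

lemma IsSmoothAlong.velocity (hJ : IsOpen J) (hγ : ContMDiffOn 𝓘(ℝ, ℝ) 𝓘(ℝ, E) ∞ γ J) :
    IsSmoothAlong (E := E) γ J (velocity γ) :=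
  (isSmoothAlong_iff hJ).2 fun t ht => isSmoothAlongAt_velocity <| by
    filter_upwards [hJ.mem_nhds ht] with s hs using hγ.contMDiffAt (hJ.mem_nhds hs)

lemma IsSmoothAlong.covDeriv (hJ : IsOpen J) (hV : IsSmoothAlong γ J V) :
    IsSmoothAlong γ J (covDeriv γ V) :=
  (isSmoothAlong_iff hJ).2 fun t ht => isSmoothAlongAt_covDeriv <| by
    filter_upwards [hJ.mem_nhds ht] with s hs using (isSmoothAlong_iff hJ).1 hV s hs

lemma covDerivIter_succ (γ : ℝ → M) (k : ℕ) :
    covDerivIter (E := E) γ (k + 1) = TriharmonicCurve.covDeriv γ (covDerivIter γ k) :=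
  Function.iterate_succ_apply' _ _ _

lemma isSmoothAlong_covDerivIter (hJ : IsOpen J) (hγ : ContMDiffOn 𝓘(ℝ, ℝ) 𝓘(ℝ, E) ∞ γ J)
    (k : ℕ) : IsSmoothAlong (E := E) γ J (covDerivIter γ k) := by
  induction k with
  | zero => exact IsSmoothAlong.velocity hJ hγ
  | succ k ih => rw [covDerivIter_succ]; exact ih.covDeriv hJ

/-! ### The curvature tensor -/

lemma curvatureTensor_swap (p : M) (u v w : TangentSpace 𝓘(ℝ, E) p) :
    curvatureTensor p u v w = -curvatureTensor p v u w := by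
  rw [curvatureTensor, curvatureTensor, coordCurvature_swap]
  exact map_neg _ _

lemma curvatureTensor_add_left (p : M) (u u' v w : TangentSpace 𝓘(ℝ, E) p) :
    curvatureTensor p (u + u') v w = curvatureTensor p u v w + curvatureTensor p u' v w := by
  rw [curvatureTensor, map_add, (isMetricOn_chartMetric p).coordCurvature_add_left
    (mem_extChartAt_target (I := 𝓘(ℝ, E)) p)]
  exact map_add _ _ _

lemma curvatureTensor_smul_left (p : M) (a : ℝ) (u v w : TangentSpace 𝓘(ℝ, E) p) :
    curvatureTensor p (a • u) v w = a • curvatureTensor p u v w := by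
  rw [curvatureTensor, map_smul, (isMetricOn_chartMetric p).coordCurvature_smul_left
    (mem_extChartAt_target (I := 𝓘(ℝ, E)) p)]
  exact map_smul _ _ _

lemma inner_curvatureTensor_self (p : M) (u v w : TangentSpace 𝓘(ℝ, E) p) :
    inner ℝ (curvatureTensor p u v w) w = 0 := by
  rw [← chartMetric_toCoord (mem_chart_source E p), curvatureTensor, toCoord_ofCoordSelf]
  exact (isMetricOn_chartMetric p).apply_coordCurvature_self
    (mem_extChartAt_target (I := 𝓘(ℝ, E)) p) _ _ _

end AlongCurve

/-! ### Gluing local sections that are unique up to sign. -/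

/-- A section over an interval that is locally determined up to sign exists globally if it exists
locally. -/
lemma exists_section_of_local {F : ℝ → Type*} [∀ t, Neg (F t)] {J : Set ℝ}
    (hJo : IsOpen J) (hJ' : J.OrdConnected) {t₀ : ℝ} (ht₀ : t₀ ∈ J) (P : ℝ → (∀ t, F t) → Prop)
    (hcongr : ∀ t B B', (∀ᶠ s in 𝓝 t, B' s = B s) → P t B → P t B')
    (hneg : ∀ t B, P t B → P t (fun s => -B s))
    (hne : ∀ t B, P t B → B t ≠ -B t)
    (hloc : ∀ t ∈ J, ∃ B, ∀ᶠ s in 𝓝 t, P s B)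
    (huniq : ∀ U, IsOpen U → IsPreconnected U → ∀ B B', (∀ t ∈ U, P t B) → (∀ t ∈ U, P t B') →
      (∀ t ∈ U, B t = B' t) ∨ (∀ t ∈ U, B t = -B' t)) :
    ∃ B, ∀ t ∈ J, P t B := by
  classical
  have hint : ∀ U V : Set ℝ, IsPreconnected U → IsPreconnected V → IsPreconnected (U ∩ V) := by
    intro U V hU hV
    rw [isPreconnected_iff_ordConnected] at *
    exact hU.inter hV
  have hloc' : ∀ t ∈ J, ∃ U B, IsOpen U ∧ IsPreconnected U ∧ t ∈ U ∧ ∀ s ∈ U, P s B := by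
    intro t ht
    obtain ⟨B, hB⟩ := hloc t ht
    obtain ⟨ε, hε, h⟩ := Metric.eventually_nhds_iff_ball.1 hB
    exact ⟨_, B, Metric.isOpen_ball, (convex_ball t ε).isPreconnected,
      Metric.mem_ball_self hε, h⟩
  obtain ⟨U₀, B₀, hU₀, hU₀c, ht₀U₀, hB₀⟩ := hloc' t₀ ht₀
  -- The good points are those joined to `t₀` by a connected open set carrying a section;
  -- prescribing the value at `t₀` fixes the sign. They form an open set, closed relative to the
  -- connected set `J`.
  have hgood : ∀ t, t ∈ J → t ∈ {t | ∃ U B, IsOpen U ∧ IsPreconnected U ∧ t₀ ∈ U ∧ t ∈ U ∧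
      (∀ s ∈ U, P s B) ∧ B t₀ = B₀ t₀} := by
    refine (isPreconnected_iff_ordConnected.2 hJ').subset_of_closure_inter_subset ?_
      ⟨t₀, ht₀, U₀, B₀, hU₀, hU₀c, ht₀U₀, ht₀U₀, hB₀, rfl⟩ ?_
    · refine isOpen_iff_mem_nhds.2 fun t ⟨U, B, hU, hUc, h0, ht, hB, h⟩ => ?_
      filter_upwards [hU.mem_nhds ht] with s hs using ⟨U, B, hU, hUc, h0, hs, hB, h⟩
    · rintro t ⟨htc, htJ⟩
      obtain ⟨V, B', hV, hVc, htV, hB'⟩ := hloc' t htJ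
      obtain ⟨s, hsV, U, B, hU, hUc, h0, hsU, hB, hBt₀⟩ := mem_closure_iff.1 htc V hV htV
      -- `B''` is `±B'`, with the sign chosen to match `B` on the connected overlap, so the two can
      -- be pasted.
      obtain ⟨B'', hB'', heq⟩ : ∃ B'', (∀ r ∈ V, P r B'') ∧ ∀ r ∈ U ∩ V, B r = B'' r := by
        rcases huniq (U ∩ V) (hU.inter hV) (hint U V hUc hVc) B B'
          (fun r hr => hB r hr.1) (fun r hr => hB' r hr.2) with h | h
        · exact ⟨B', hB', h⟩
        · exact ⟨_, fun r hr => hneg r B' (hB' r hr), h⟩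
      refine ⟨U ∪ V, fun r => if r ∈ U then B r else B'' r, hU.union hV,
        hUc.union s hsU hsV hVc, .inl h0, .inr htV, ?_, by simp [h0, hBt₀]⟩
      rintro r (hr | hr)
      · refine hcongr r B _ ?_ (hB r hr)
        filter_upwards [hU.mem_nhds hr] with x hx using by simp [hx]
      · refine hcongr r B'' _ ?_ (hB'' r hr)
        filter_upwards [hV.mem_nhds hr] with x hx
        by_cases hxU : x ∈ U
        · simp [hxU, heq x ⟨hxU, hx⟩]
        · simp [hxU]
  have : Nonempty (∀ t, F t) := ⟨B₀⟩
  choose! U B hU hUc h0 ht hB hBt₀ using hgood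
  -- The diagonal section is locally one of the chosen ones: `B r` and `B t` agree at `t₀`, so on
  -- the connected set `U r ∩ U t` they cannot differ by a sign.
  refine ⟨fun t => B t t, fun t htJ => hcongr t (B t) _ ?_ (hB _ htJ t (ht _ htJ))⟩
  filter_upwards [(hU _ htJ).mem_nhds (ht _ htJ), hJo.mem_nhds htJ] with r hr hrJ
  rcases huniq (U r ∩ U t) ((hU _ hrJ).inter (hU _ htJ)) (hint _ _ (hUc _ hrJ) (hUc _ htJ))
    (B r) (B t)
    (fun x hx => hB _ hrJ x hx.1) (fun x hx => hB _ htJ x hx.2) with h | h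
  · exact h r ⟨ht _ hrJ, hr⟩
  · have := h t₀ ⟨h0 _ hrJ, h0 _ htJ⟩
    rw [hBt₀ _ hrJ, hBt₀ _ htJ] at this
    exact (hne t₀ B₀ (hB₀ t₀ ht₀U₀) this).elim

/-! ### Orthonormal triples in a three-dimensional inner product space. -/

section LinearAlgebra

variable {V : Type*} [NormedAddCommGroup V] [InnerProductSpace ℝ V]

lemma orthonormal_triple_iff {a b c : V} :
    Orthonormal ℝ ![a, b, c] ↔ inner ℝ a a = 1 ∧ inner ℝ b b = 1 ∧ inner ℝ c c = 1 ∧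
      inner ℝ a b = 0 ∧ inner ℝ a c = 0 ∧ inner ℝ b c = 0 := by
  rw [orthonormal_iff_ite]
  simp only [Fin.forall_fin_succ]
  simp [-inner_self_eq_norm_sq_to_K]
  rw [real_inner_comm a b, real_inner_comm a c, real_inner_comm b c]
  tauto

lemma Orthonormal.eq_sum_triple (hV : Module.finrank ℝ V = 3) {a b c : V}
    (h : Orthonormal ℝ ![a, b, c]) (x : V) :
    x = inner ℝ a x • a + inner ℝ b x • b + inner ℝ c x • c := by
  have : FiniteDimensional ℝ V := Module.finite_of_finrank_eq_succ hV
  let e := basisOfOrthonormalOfCardEqFinrank h (by simp [hV])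
  have he : ⇑e = ![a, b, c] := coe_basisOfOrthonormalOfCardEqFinrank h (by simp [hV])
  let o := e.toOrthonormalBasis (by rw [he]; exact h)
  have ho : ⇑o = ![a, b, c] := by simp [o, he]
  have := o.sum_repr' x
  simpa [Fin.sum_univ_three, ho] using this.symm

lemma exists_orthonormal_triple (hV : Module.finrank ℝ V = 3) {a b : V}
    (ha : inner ℝ a a = 1) (hb : inner ℝ b b = 1) (hab : inner ℝ a b = 0) :
    ∃ c, Orthonormal ℝ ![a, b, c] := by
  have : FiniteDimensional ℝ V := Module.finite_of_finrank_eq_succ hV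
  have hlt : Module.finrank ℝ (Submodule.span ℝ {a, b}) < 3 := by
    classical
    have := (finrank_span_finset_le_card (R := ℝ) ({a, b} : Finset V)).trans Finset.card_le_two
    simp only [Finset.coe_insert, Finset.coe_singleton] at this
    exact Nat.lt_succ_of_le this
  have hne : (Submodule.span ℝ {a, b})ᗮ ≠ ⊥ := by
    intro h
    rw [Submodule.orthogonal_eq_bot_iff] at h
    rw [h, finrank_top, hV] at hlt
    exact lt_irrefl _ hlt
  obtain ⟨c, hc, hc0⟩ := Submodule.exists_mem_ne_zero_of_ne_bot hne
  have hac := (Submodule.mem_orthogonal _ _).1 hc a (Submodule.subset_span (by simp))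
  have hbc := (Submodule.mem_orthogonal _ _).1 hc b (Submodule.subset_span (by simp))
  refine ⟨‖c‖⁻¹ • c, orthonormal_triple_iff.2 ⟨ha, hb, ?_, hab, ?_, ?_⟩⟩
  · have := norm_ne_zero_iff.2 hc0
    rw [inner_smul_left, inner_smul_right, real_inner_self_eq_norm_sq]
    simp
    field_simp
  · rw [inner_smul_right, hac, mul_zero]
  · rw [inner_smul_right, hbc, mul_zero]

end LinearAlgebra

/-! ### Constancy of the torsion and the equations in a Frenet frame. -/

section Curves

variable {E : Type*} [NormedAddCommGroup E] [NormedSpace ℝ E] [FiniteDimensional ℝ E]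
  {M : Type*} [TopologicalSpace M] [ChartedSpace E M] [IsManifold 𝓘(ℝ, E) ∞ M]
  [Bundle.RiemannianBundle (fun x : M => TangentSpace 𝓘(ℝ, E) x)]
  [IsContMDiffRiemannianBundle 𝓘(ℝ, E) ∞ E (fun x : M => TangentSpace 𝓘(ℝ, E) x)]
  {γ : ℝ → M} {J : Set ℝ} {κ₀ : ℝ}

/-- Serves to differentiate an identity that holds only on `J`. -/
lemma HasDerivAt.unique_of_eqOn {f g : ℝ → ℝ} {f' g' t : ℝ} (hJ : IsOpen J) (ht : t ∈ J)
    (h : ∀ s ∈ J, f s = g s) (hf : HasDerivAt f f' t) (hg : HasDerivAt g g' t) : f' = g' :=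
  hf.unique (hg.congr_of_eventuallyEq (by filter_upwards [hJ.mem_nhds ht] with s hs using h s hs))

lemma inner_velocity_self (h : IsArcLengthCurve (E := E) γ J) {t : ℝ} (ht : t ∈ J) :
    inner ℝ (velocity (E := E) γ t) (velocity γ t) = 1 := by
  rw [real_inner_self_eq_norm_sq, h.unit_speed t ht, one_pow]

lemma hasDerivAt_inner_covDerivIter (hJ : IsOpen J) (h : IsArcLengthCurve (E := E) γ J) {t : ℝ}
    (ht : t ∈ J) (j k : ℕ) :
    HasDerivAt (fun s => inner ℝ (covDerivIter (E := E) γ j s) (covDerivIter γ k s))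
      (inner ℝ (covDerivIter (E := E) γ (j + 1) t) (covDerivIter γ k t)
        + inner ℝ (covDerivIter (E := E) γ j t) (covDerivIter γ (k + 1) t)) t := by
  rw [covDerivIter_succ, covDerivIter_succ]
  exact ((isSmoothAlong_iff hJ).1 (isSmoothAlong_covDerivIter hJ h.smooth j) t ht).hasDerivAt_inner
    ((isSmoothAlong_iff hJ).1 (isSmoothAlong_covDerivIter hJ h.smooth k) t ht)

/-- The tangential part of the triharmonic equation: along a triharmonic curve of constant
curvature, `‖∇_T^2 T‖` is constant. -/
lemma IsTriharmonic.norm_covDerivIter_two_const (hJ : IsOpen J) (hJ' : J.OrdConnected)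
    (h : IsTriharmonic E γ J) (hκ : ∀ t ∈ J, curvature E γ t = κ₀) :
    ∃ c, ∀ t ∈ J, inner ℝ (covDerivIter (E := E) γ 2 t) (covDerivIter γ 2 t) = c := by
  have hd := fun {t : ℝ} (ht : t ∈ J) => hasDerivAt_inner_covDerivIter hJ h.arcLength ht
  have hcomm : ∀ j k t, inner ℝ (covDerivIter (E := E) γ j t) (covDerivIter γ k t) =
      inner ℝ (covDerivIter (E := E) γ k t) (covDerivIter γ j t) :=
    fun j k t => real_inner_comm _ _
  have h00 : ∀ t ∈ J, inner ℝ (covDerivIter (E := E) γ 0 t) (covDerivIter γ 0 t) = 1 :=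
    fun t ht => inner_velocity_self h.arcLength ht
  have h11 : ∀ t ∈ J, inner ℝ (covDerivIter (E := E) γ 1 t) (covDerivIter γ 1 t) = κ₀ ^ 2 :=
    fun t ht => by rw [real_inner_self_eq_norm_sq, ← hκ t ht, curvature]
  have h01 : ∀ t ∈ J, inner ℝ (covDerivIter (E := E) γ 0 t) (covDerivIter γ 1 t) = 0 :=
    fun t ht => by
      have := HasDerivAt.unique_of_eqOn hJ ht h00 (hd ht 0 0) (hasDerivAt_const t 1)
      linarith [hcomm 0 1 t]
  have h12 : ∀ t ∈ J, inner ℝ (covDerivIter (E := E) γ 1 t) (covDerivIter γ 2 t) = 0 :=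
    fun t ht => by
      have := HasDerivAt.unique_of_eqOn hJ ht h11 (hd ht 1 1) (hasDerivAt_const t _)
      linarith [hcomm 1 2 t]
  have h02 : ∀ t ∈ J, inner ℝ (covDerivIter (E := E) γ 0 t) (covDerivIter γ 2 t) = -κ₀ ^ 2 :=
    fun t ht => by
      have := HasDerivAt.unique_of_eqOn hJ ht h01 (hd ht 0 1) (hasDerivAt_const t _)
      linarith [h11 t ht]
  have h03 : ∀ t ∈ J, inner ℝ (covDerivIter (E := E) γ 0 t) (covDerivIter γ 3 t) = 0 :=
    fun t ht => by
      have := HasDerivAt.unique_of_eqOn hJ ht h02 (hd ht 0 2) (hasDerivAt_const t _)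
      linarith [h12 t ht]
  have h13 : ∀ t ∈ J, inner ℝ (covDerivIter (E := E) γ 1 t) (covDerivIter γ 3 t) =
      -inner ℝ (covDerivIter (E := E) γ 2 t) (covDerivIter γ 2 t) :=
    fun t ht => by
      have := HasDerivAt.unique_of_eqOn hJ ht h12 (hd ht 1 2) (hasDerivAt_const t _)
      linarith
  have h04 : ∀ t ∈ J, inner ℝ (covDerivIter (E := E) γ 0 t) (covDerivIter γ 4 t) =
      inner ℝ (covDerivIter (E := E) γ 2 t) (covDerivIter γ 2 t) :=
    fun t ht => by
      have := HasDerivAt.unique_of_eqOn hJ ht h03 (hd ht 0 3) (hasDerivAt_const t _)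
      linarith [h13 t ht]
  -- Both curvature terms have the form `R(·, ·) T`, hence are orthogonal to `T`.
  have h05 : ∀ t ∈ J, inner ℝ (covDerivIter (E := E) γ 5 t) (covDerivIter γ 0 t) = 0 :=
    fun t ht => by
      have := congrArg (fun v => inner ℝ v (velocity (E := E) γ t)) (h.tension_eq_zero t ht)
      simp only [inner_sub_left, inner_add_left, inner_curvatureTensor_self, add_zero, sub_zero,
        inner_zero_left] at this
      exact this
  have h22 : ∀ t ∈ J, HasDerivAt
      (fun s => inner ℝ (covDerivIter (E := E) γ 2 s) (covDerivIter γ 2 s)) 0 t := fun t ht => by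
    -- With `f = ‖T_2‖²` and `f' = 2⟨T_2, T_3⟩`, `e1` gives `⟨T_1, T_4⟩ = -(3/2) f'`, while `e2` and
    -- `h05` give `⟨T_1, T_4⟩ = f'`.
    have e1 := HasDerivAt.unique_of_eqOn hJ ht h13 (hd ht 1 3) (hd ht 2 2).neg
    have e2 := HasDerivAt.unique_of_eqOn hJ ht h04 (hd ht 0 4) (hd ht 2 2)
    refine (hd ht 2 2).congr_deriv ?_
    linarith [hcomm 2 3 t, hcomm 0 5 t, h05 t ht]
  obtain ⟨c, hc⟩ := hJ.exists_is_const_of_deriv_eq_zero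
    (isPreconnected_iff_ordConnected.2 hJ')
    (fun t ht => (h22 t ht).differentiableAt.differentiableWithinAt) (fun t ht => (h22 t ht).deriv)
  exact ⟨c, hc⟩

section Frame

variable {τ : ℝ → ℝ} {N B : ∀ t, TangentSpace 𝓘(ℝ, E) (γ t)}

lemma IsFrenetFrame.smoothAt_normal (hF : IsFrenetFrame γ J τ N B) (hJ : IsOpen J) {t : ℝ}
    (ht : t ∈ J) : IsSmoothAlongAt γ N t :=
  (isSmoothAlong_iff hJ).1 hF.smooth_normal t ht

lemma IsFrenetFrame.smoothAt_binormal (hF : IsFrenetFrame γ J τ N B) (hJ : IsOpen J) {t : ℝ}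
    (ht : t ∈ J) : IsSmoothAlongAt γ B t :=
  (isSmoothAlong_iff hJ).1 hF.smooth_binormal t ht

lemma IsFrenetFrame.covDerivIter_one (hF : IsFrenetFrame γ J τ N B)
    (hκ : ∀ t ∈ J, curvature E γ t = κ₀) {t : ℝ} (ht : t ∈ J) :
    covDerivIter γ 1 t = κ₀ • N t := by
  rw [← hκ t ht]
  exact hF.deriv_tangent t ht

lemma IsFrenetFrame.covDerivIter_two (hF : IsFrenetFrame γ J τ N B) (hJ : IsOpen J)
    (hκ : ∀ t ∈ J, curvature E γ t = κ₀) {t : ℝ} (ht : t ∈ J) :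
    covDerivIter γ 2 t = -κ₀ ^ 2 • velocity γ t + (κ₀ * τ t) • B t := by
  rw [covDerivIter_succ, covDeriv_congr (W := fun s => κ₀ • N s) (by
      filter_upwards [hJ.mem_nhds ht] with s hs using hF.covDerivIter_one hκ hs),
    covDeriv_const_smul _ (hF.smoothAt_normal hJ ht), hF.deriv_normal t ht, hκ t ht]
  module

/-- The constant `‖∇_T^2 T‖²` equals `κ₀⁴ + κ₀² τ²` in the frame; dividing by `κ₀² ≠ 0` fixes `τ²`,
and continuity on the interval fixes the sign. -/
lemma IsTriharmonic.torsion_const (hJ : IsOpen J) (hJ' : J.OrdConnected)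
    (h : IsTriharmonic E γ J) (hκ : ∀ t ∈ J, curvature E γ t = κ₀) (hκ₀ : κ₀ ≠ 0)
    (hF : IsFrenetFrame γ J τ N B) : ∃ τ₀, ∀ t ∈ J, τ t = τ₀ := by
  obtain ⟨c, hc⟩ := h.norm_covDerivIter_two_const hJ hJ' hκ
  have hsq : ∀ t ∈ J, κ₀ ^ 4 + κ₀ ^ 2 * τ t ^ 2 = c := fun t ht => by
    obtain ⟨h1, -, h3, -, h13, -⟩ := orthonormal_triple_iff.1 (hF.orthonormal t ht)
    have h31 : inner ℝ (B t) (velocity γ t) = 0 := by rw [real_inner_comm, h13]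
    rw [← hc t ht, hF.covDerivIter_two hJ hκ ht]
    simp only [inner_add_left, inner_add_right, real_inner_smul_left, real_inner_smul_right, h1,
      h3, h13, h31]
    ring
  -- Regularity of `τ` is not part of `IsFrenetFrame`; it follows from `τ = ⟨∇_T N, B⟩`.
  have hcont : ContinuousOn τ J := by
    have : ∀ t ∈ J, τ t = inner ℝ (covDeriv γ N t) (B t) := fun t ht => by
      obtain ⟨-, -, h3, -, h13, -⟩ := orthonormal_triple_iff.1 (hF.orthonormal t ht)
      rw [hF.deriv_normal t ht]
      simp only [inner_add_left, real_inner_smul_left, h3, h13]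
      ring
    refine ContinuousOn.congr (fun t ht => ?_) this
    exact (((isSmoothAlong_iff hJ).1 (hF.smooth_normal.covDeriv hJ) t ht).contDiffAt_inner
      (hF.smoothAt_binormal hJ ht)).continuousAt.continuousWithinAt
  rcases J.eq_empty_or_nonempty with rfl | ⟨t₀, ht₀⟩
  · exact ⟨0, by simp⟩
  have hsq' : ∀ t ∈ J, τ t ^ 2 = τ t₀ ^ 2 := fun t ht =>
    mul_left_cancel₀ (pow_ne_zero 2 hκ₀) (by linarith [hsq t ht, hsq t₀ ht₀])
  by_cases h0 : τ t₀ = 0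
  · exact ⟨0, fun t ht => by simpa [h0] using hsq' t ht⟩
  · refine ⟨τ t₀, (isPreconnected_iff_ordConnected.2 hJ').eq_of_sq_eq hcont
      continuousOn_const hsq' (fun _ => h0) ht₀ rfl⟩

lemma IsFrenetFrame.covDerivIter_three (hJ : IsOpen J) (hγ : IsArcLengthCurve (E := E) γ J)
    (hκ : ∀ t ∈ J, curvature E γ t = κ₀) {τ₀ : ℝ} (hF : IsFrenetFrame γ J τ N B)
    (hτ : ∀ t ∈ J, τ t = τ₀) {t : ℝ} (ht : t ∈ J) :
    covDerivIter (E := E) γ 3 t = -(κ₀ ^ 2 + τ₀ ^ 2) • covDerivIter (E := E) γ 1 t := by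
  have hT : IsSmoothAlongAt (E := E) γ (velocity γ) t :=
    (isSmoothAlong_iff hJ).1 (IsSmoothAlong.velocity hJ hγ.smooth) t ht
  have hB := hF.smoothAt_binormal hJ ht
  rw [covDerivIter_succ, covDeriv_congr
      (W := fun s => -κ₀ ^ 2 • velocity γ s + (κ₀ * τ₀) • B s) (by
      filter_upwards [hJ.mem_nhds ht] with s hs
      rw [hF.covDerivIter_two hJ hκ hs, hτ s hs]),
    covDeriv_add (hT.smul contDiffAt_const) (hB.smul contDiffAt_const),
    covDeriv_const_smul _ hT, covDeriv_const_smul _ hB, hF.deriv_binormal t ht,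
    hF.deriv_tangent t ht, hF.covDerivIter_one hκ ht, hκ t ht, hτ t ht]
  module

lemma IsFrenetFrame.covDerivIter_five (hJ : IsOpen J) (hγ : IsArcLengthCurve (E := E) γ J)
    (hκ : ∀ t ∈ J, curvature E γ t = κ₀) {τ₀ : ℝ} (hF : IsFrenetFrame γ J τ N B)
    (hτ : ∀ t ∈ J, τ t = τ₀) {t : ℝ} (ht : t ∈ J) :
    covDerivIter (E := E) γ 5 t = (κ₀ ^ 2 + τ₀ ^ 2) ^ 2 • covDerivIter (E := E) γ 1 t := by
  have hs := fun k => isSmoothAlong_covDerivIter hJ hγ.smooth k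
  have h3 := fun {s} (hs : s ∈ J) => hF.covDerivIter_three hJ hγ hκ hτ hs
  have h4 : ∀ s ∈ J, covDerivIter (E := E) γ 4 s =
      -(κ₀ ^ 2 + τ₀ ^ 2) • covDerivIter γ 2 s := fun s hsJ => by
    rw [covDerivIter_succ, covDeriv_congr
        (W := fun s => -(κ₀ ^ 2 + τ₀ ^ 2) • covDerivIter γ 1 s) (by
        filter_upwards [hJ.mem_nhds hsJ] with r hr using h3 hr),
      covDeriv_const_smul _ ((isSmoothAlong_iff hJ).1 (hs 1) s hsJ), ← covDerivIter_succ]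
  rw [covDerivIter_succ, covDeriv_congr
      (W := fun s => -(κ₀ ^ 2 + τ₀ ^ 2) • covDerivIter γ 2 s) (by
      filter_upwards [hJ.mem_nhds ht] with r hr using h4 r hr),
    covDeriv_const_smul _ ((isSmoothAlong_iff hJ).1 (hs 2) t ht), ← covDerivIter_succ, h3 ht]
  module

/-- The triharmonic equation in a Frenet frame with constant curvature and torsion. -/
lemma IsTriharmonic.frenet_equation (hJ : IsOpen J)
    (h : IsTriharmonic E γ J) (hκ : ∀ t ∈ J, curvature E γ t = κ₀) (hκ₀ : κ₀ ≠ 0)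
    {τ₀ : ℝ} (hF : IsFrenetFrame γ J τ N B) (hτ : ∀ t ∈ J, τ t = τ₀) {t : ℝ} (ht : t ∈ J) :
    (κ₀ ^ 2 + τ₀ ^ 2) ^ 2 • N t
      - (2 * κ₀ ^ 2 + τ₀ ^ 2) • curvatureTensor (γ t) (N t) (velocity γ t) (velocity γ t)
      - (κ₀ * τ₀) • curvatureTensor (γ t) (B t) (N t) (velocity γ t) = 0 := by
  have key := h.tension_eq_zero t ht
  -- Only additivity and homogeneity in the first slot are available, so the second slot is reached
  -- by swapping twice. The `κ₀²` here joins `κ₀² + τ₀²` from `∇_T^3 T` to make the coefficient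
  -- `2κ₀² + τ₀²`.
  have hR : curvatureTensor (γ t) (covDerivIter γ 2 t) (covDerivIter γ 1 t) (velocity γ t) =
      κ₀ • (κ₀ ^ 2 • curvatureTensor (γ t) (N t) (velocity γ t) (velocity γ t)
        + (κ₀ * τ₀) • curvatureTensor (γ t) (B t) (N t) (velocity γ t)) := by
    rw [hF.covDerivIter_two hJ hκ ht, hF.covDerivIter_one hκ ht, curvatureTensor_swap,
      curvatureTensor_smul_left, curvatureTensor_swap, curvatureTensor_add_left,
      curvatureTensor_smul_left, curvatureTensor_smul_left,
      curvatureTensor_swap _ (velocity γ t), hτ t ht]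
    module
  rw [hR, hF.covDerivIter_five hJ h.arcLength hκ hτ ht,
    hF.covDerivIter_three hJ h.arcLength hκ hτ ht, hF.covDerivIter_one hκ ht,
    curvatureTensor_smul_left, curvatureTensor_smul_left] at key
  refine (smul_eq_zero.1 (Eq.trans ?_ key)).resolve_left hκ₀
  module

lemma IsTriharmonic.frenet_equations (hJ : IsOpen J)
    (h : IsTriharmonic E γ J) (hκ : ∀ t ∈ J, curvature E γ t = κ₀) (hκ₀ : κ₀ ≠ 0)
    {τ₀ : ℝ} (hF : IsFrenetFrame γ J τ N B) (hτ : ∀ t ∈ J, τ t = τ₀) {t : ℝ} (ht : t ∈ J) :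
    (κ₀ ^ 2 + τ₀ ^ 2) ^ 2
        - (2 * κ₀ ^ 2 + τ₀ ^ 2)
          * inner ℝ (curvatureTensor (γ t) (N t) (velocity γ t) (velocity γ t)) (N t)
        - κ₀ * τ₀ * inner ℝ (curvatureTensor (γ t) (B t) (N t) (velocity γ t)) (N t) = 0 ∧
      (2 * κ₀ ^ 2 + τ₀ ^ 2)
          * inner ℝ (curvatureTensor (γ t) (N t) (velocity γ t) (velocity γ t)) (B t)
        + κ₀ * τ₀ * inner ℝ (curvatureTensor (γ t) (B t) (N t) (velocity γ t)) (B t) = 0 := by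
  have key := h.frenet_equation hJ hκ hκ₀ hF hτ ht
  obtain ⟨-, h2, -, -, -, h23⟩ := orthonormal_triple_iff.1 (hF.orthonormal t ht)
  have hN := congrArg (fun v => inner ℝ v (N t)) key
  have hB := congrArg (fun v => inner ℝ v (B t)) key
  simp only [inner_sub_left, real_inner_smul_left, inner_zero_left, h2, h23] at hN hB
  exact ⟨by linarith, by linarith⟩

end Frame

end Curves

/-! ### Existence of a Frenet frame when the curvature is a nonzero constant. -/

section FrameExistence

variable {E : Type*} [NormedAddCommGroup E] [NormedSpace ℝ E] [FiniteDimensional ℝ E]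
  {M : Type*} [TopologicalSpace M] [ChartedSpace E M] [IsManifold 𝓘(ℝ, E) ∞ M]
  [Bundle.RiemannianBundle (fun x : M => TangentSpace 𝓘(ℝ, E) x)]
  [IsContMDiffRiemannianBundle 𝓘(ℝ, E) ∞ E (fun x : M => TangentSpace 𝓘(ℝ, E) x)]
  {γ : ℝ → M} {J : Set ℝ} {κ₀ : ℝ} {T N : ∀ t, TangentSpace 𝓘(ℝ, E) (γ t)}

lemma finrank_tangentSpace (hE : Module.finrank ℝ E = 3) (p : M) :
    Module.finrank ℝ (TangentSpace 𝓘(ℝ, E) p) = 3 := hE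

/-- Every tangent vector at a point of a smooth curve extends to a smooth field along the curve
near this point. -/
lemma exists_smooth_extension {t : ℝ} (hγ : ∀ᶠ s in 𝓝 t, ContMDiffAt 𝓘(ℝ, ℝ) 𝓘(ℝ, E) ∞ γ s)
    (c : TangentSpace 𝓘(ℝ, E) (γ t)) :
    ∃ V : ∀ s, TangentSpace 𝓘(ℝ, E) (γ s), V t = c ∧ ∀ᶠ s in 𝓝 t, IsSmoothAlongAt γ V s := by
  have ht := mem_chart_source E (γ t)
  -- The extension has constant components in the chart around `γ t`; the values of `invFun` away
  -- from that chart play no role.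
  have hV : ∀ s, γ s ∈ (chartAt E (γ t)).source → toCoord (γ t) (γ s)
      (Function.invFun (toCoord (E := E) (γ t) (γ s)) (toCoord (γ t) (γ t) c)) =
        toCoord (γ t) (γ t) c := fun s hs => Function.invFun_eq (toCoord_surjective hs _)
  refine ⟨fun s => Function.invFun (toCoord (E := E) (γ t) (γ s)) (toCoord (γ t) (γ t) c),
    toCoord_injective ht (hV t ht), ?_⟩
  filter_upwards [hγ, (eventually_mem_source hγ.self_of_nhds.continuousAt ht).eventually_nhds]
    with s hγs hs
  rw [isSmoothAlongAt_iff hγs hs.self_of_nhds]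
  refine (contDiffAt_const (c := toCoord (γ t) (γ t) c)).congr_of_eventuallyEq ?_
  filter_upwards [hs] with r hr using hV r hr

/-- Gram–Schmidt: extend a unit normal `c` at `t` smoothly, project away `T` and `N`, and normalize.
The projected field equals `c` at `t`, so it stays nonzero only nearby, which is why the result is
local. -/
lemma exists_local_binormal (hE : Module.finrank ℝ E = 3) {t : ℝ}
    (hT : ∀ᶠ s in 𝓝 t, IsSmoothAlongAt γ T s) (hN : ∀ᶠ s in 𝓝 t, IsSmoothAlongAt γ N s)
    (h : ∀ᶠ s in 𝓝 t, inner ℝ (T s) (T s) = 1 ∧ inner ℝ (N s) (N s) = 1 ∧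
      inner ℝ (T s) (N s) = 0) :
    ∃ B : ∀ s, TangentSpace 𝓘(ℝ, E) (γ s), ∀ᶠ s in 𝓝 t,
      IsSmoothAlongAt γ B s ∧ Orthonormal ℝ ![T s, N s, B s] := by
  obtain ⟨c, hc⟩ := exists_orthonormal_triple (finrank_tangentSpace hE (γ t))
    h.self_of_nhds.1 h.self_of_nhds.2.1 h.self_of_nhds.2.2
  obtain ⟨V, hVt, hV⟩ := exists_smooth_extension (hT.mono fun _ hs => hs.contMDiffAt) c
  obtain ⟨-, -, hcc, -, hTc, hNc⟩ := orthonormal_triple_iff.1 hc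
  let W : ∀ s, TangentSpace 𝓘(ℝ, E) (γ s) := fun s =>
    V s + (-inner ℝ (T s) (V s)) • T s + (-inner ℝ (N s) (V s)) • N s
  have hW : ∀ᶠ s in 𝓝 t, IsSmoothAlongAt γ W s := by
    filter_upwards [hT, hN, hV] with s hT hN hV
    exact (hV.add (hT.smul (hT.contDiffAt_inner hV).neg)).add
      (hN.smul (hN.contDiffAt_inner hV).neg)
  have hWt : inner ℝ (W t) (W t) = 1 := by
    simp only [W, hVt, hTc, hNc, neg_zero, zero_smul, add_zero, hcc]
  have hpos : ∀ᶠ s in 𝓝 t, 0 < inner ℝ (W s) (W s) :=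
    (hW.self_of_nhds.contDiffAt_inner hW.self_of_nhds).continuousAt.eventually_const_lt
      (show 0 < inner ℝ (W t) (W t) by rw [hWt]; exact one_pos)
  refine ⟨fun s => (√(inner ℝ (W s) (W s)))⁻¹ • W s, ?_⟩
  filter_upwards [hW, hpos, h] with s hW hpos ⟨hTT, hNN, hTN⟩
  have hNT : inner ℝ (N s) (T s) = 0 := by rw [real_inner_comm, hTN]
  have hTW : inner ℝ (T s) (W s) = 0 := by
    simp only [W, inner_add_right, real_inner_smul_right, hTT, hTN]
    ring
  have hNW : inner ℝ (N s) (W s) = 0 := by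
    simp only [W, inner_add_right, real_inner_smul_right, hNN, hNT]
    ring
  refine ⟨hW.smul (((hW.contDiffAt_inner hW).sqrt hpos.ne').inv (Real.sqrt_pos.2 hpos).ne'),
    orthonormal_triple_iff.2 ⟨hTT, hNN, ?_, hTN, ?_, ?_⟩⟩
  · rw [real_inner_smul_left, real_inner_smul_right, ← mul_assoc, ← mul_inv,
      Real.mul_self_sqrt hpos.le, inv_mul_cancel₀ hpos.ne']
  · rw [real_inner_smul_right, hTW, mul_zero]
  · rw [real_inner_smul_right, hNW, mul_zero]

/-- The complement of `T`, `N` is a line, so `B = ⟨B', B⟩ B'`, and the continuous function `⟨B', B⟩`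
has square `1` on a connected set. -/
lemma binormal_unique (hE : Module.finrank ℝ E = 3) {U : Set ℝ} (hU : IsPreconnected U)
    {B B' : ∀ t, TangentSpace 𝓘(ℝ, E) (γ t)}
    (hB : ∀ t ∈ U, IsSmoothAlongAt γ B t ∧ Orthonormal ℝ ![T t, N t, B t])
    (hB' : ∀ t ∈ U, IsSmoothAlongAt γ B' t ∧ Orthonormal ℝ ![T t, N t, B' t]) :
    (∀ t ∈ U, B t = B' t) ∨ (∀ t ∈ U, B t = -B' t) := by
  have hexp : ∀ t ∈ U, B t = inner ℝ (B' t) (B t) • B' t := fun t ht => by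
    obtain ⟨-, -, -, -, h13, h23⟩ := orthonormal_triple_iff.1 (hB t ht).2
    have := Orthonormal.eq_sum_triple (finrank_tangentSpace hE (γ t)) (hB' t ht).2 (B t)
    rwa [h13, h23, zero_smul, zero_smul, zero_add, zero_add] at this
  have hcont : ContinuousOn (fun t => inner ℝ (B' t) (B t)) U := fun t ht =>
    ((hB' t ht).1.contDiffAt_inner (hB t ht).1).continuousAt.continuousWithinAt
  have hsq : ∀ t ∈ U, inner ℝ (B' t) (B t) ^ 2 = (1 : ℝ) := fun t ht => by
    have h := (orthonormal_triple_iff.1 (hB t ht).2).2.2.1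
    nth_rewrite 1 [hexp t ht] at h
    rwa [real_inner_smul_left, ← sq] at h
  rcases hU.eq_one_or_eq_neg_one_of_sq_eq hcont hsq with h | h
  · exact .inl fun t ht => by simpa [show inner ℝ (B' t) (B t) = (1 : ℝ) from h ht] using hexp t ht
  · exact .inr fun t ht => by
      simpa [show inner ℝ (B' t) (B t) = (-1 : ℝ) from h ht] using hexp t ht

lemma exists_binormal (hE : Module.finrank ℝ E = 3) (hJ : IsOpen J) (hJ' : J.OrdConnected)
    {t₀ : ℝ} (ht₀ : t₀ ∈ J) (hT : IsSmoothAlong γ J T) (hN : IsSmoothAlong γ J N)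
    (h : ∀ t ∈ J, inner ℝ (T t) (T t) = 1 ∧ inner ℝ (N t) (N t) = 1 ∧
      inner ℝ (T t) (N t) = 0) :
    ∃ B : ∀ t, TangentSpace 𝓘(ℝ, E) (γ t), IsSmoothAlong γ J B ∧
      ∀ t ∈ J, Orthonormal ℝ ![T t, N t, B t] := by
  obtain ⟨B, hB⟩ := exists_section_of_local (F := fun t => TangentSpace 𝓘(ℝ, E) (γ t)) hJ hJ' ht₀
    (fun t B => IsSmoothAlongAt γ B t ∧ Orthonormal ℝ ![T t, N t, B t])
    (fun t B B' hBB' hB => ⟨hB.1.congr hBB', by rw [hBB'.self_of_nhds]; exact hB.2⟩)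
    (fun t B hB => ⟨by simpa using hB.1.smul (contDiffAt_const (c := (-1 : ℝ))), by
      simpa [orthonormal_triple_iff] using hB.2⟩)
    (fun t B hB heq => by
      have h1 := (orthonormal_triple_iff.1 hB.2).2.2.1
      have h2 := h1
      nth_rewrite 2 [heq] at h2
      rw [inner_neg_right, h1] at h2
      norm_num at h2)
    (fun t ht => exists_local_binormal hE
      (by filter_upwards [hJ.mem_nhds ht] with s hs using (isSmoothAlong_iff hJ).1 hT s hs)
      (by filter_upwards [hJ.mem_nhds ht] with s hs using (isSmoothAlong_iff hJ).1 hN s hs)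
      (by filter_upwards [hJ.mem_nhds ht] with s hs using h s hs))
    (fun U _ hU B B' hB hB' => binormal_unique hE hU hB hB')
  exact ⟨B, (isSmoothAlong_iff hJ).2 fun t ht => (hB t ht).1, fun t ht => (hB t ht).2⟩

/-- An arc length parametrized curve with nonzero constant curvature in a Riemannian manifold of
dimension three has a Frenet frame. -/
lemma exists_isFrenetFrame (hE : Module.finrank ℝ E = 3) (hJ : IsOpen J) (hJ' : J.OrdConnected)
    {t₀ : ℝ} (ht₀ : t₀ ∈ J) (hγ : IsArcLengthCurve (E := E) γ J)
    (hκ : ∀ t ∈ J, curvature E γ t = κ₀) (hκ₀ : κ₀ ≠ 0) :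
    ∃ (τ : ℝ → ℝ) (N B : ∀ t, TangentSpace 𝓘(ℝ, E) (γ t)), IsFrenetFrame γ J τ N B := by
  have hT := IsSmoothAlong.velocity (E := E) hJ hγ.smooth
  have hTat := fun {t : ℝ} (ht : t ∈ J) => (isSmoothAlong_iff hJ).1 hT t ht
  let N : ∀ t, TangentSpace 𝓘(ℝ, E) (γ t) := fun t => κ₀⁻¹ • covDeriv γ (velocity γ) t
  have hN : IsSmoothAlong γ J N := (isSmoothAlong_iff hJ).2 fun t ht =>
    IsSmoothAlongAt.smul contDiffAt_const ((isSmoothAlong_iff hJ).1 (hT.covDeriv hJ) t ht)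
  have hNat := fun {t : ℝ} (ht : t ∈ J) => (isSmoothAlong_iff hJ).1 hN t ht
  have hdT : ∀ t ∈ J, covDeriv γ (velocity γ) t = κ₀ • N t := fun t _ => by
    rw [smul_smul, mul_inv_cancel₀ hκ₀, one_smul]
  have hTN : ∀ t ∈ J, inner ℝ (velocity (E := E) γ t) (N t) = 0 := fun t ht => by
    have := HasDerivAt.unique_of_eqOn hJ ht (fun s hs => inner_velocity_self (E := E) hγ hs)
      ((hTat ht).hasDerivAt_inner (hTat ht)) (hasDerivAt_const t 1)
    rw [real_inner_comm] at this
    rw [real_inner_smul_right]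
    linear_combination κ₀⁻¹ / 2 * this
  have hNN : ∀ t ∈ J, inner ℝ (N t) (N t) = 1 := fun t ht => by
    have : inner ℝ (covDeriv γ (velocity (E := E) γ) t) (covDeriv γ (velocity γ) t) = κ₀ ^ 2 := by
      rw [real_inner_self_eq_norm_sq, ← hκ t ht]
      rfl
    rw [real_inner_smul_left, real_inner_smul_right, this]
    field_simp
  obtain ⟨B, hB, hTNB⟩ := exists_binormal hE hJ hJ' ht₀ hT hN
    fun t ht => ⟨inner_velocity_self hγ ht, hNN t ht, hTN t ht⟩
  have hBat := fun {t : ℝ} (ht : t ∈ J) => (isSmoothAlong_iff hJ).1 hB t ht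
  have hperp := fun {t : ℝ} (ht : t ∈ J) => orthonormal_triple_iff.1 (hTNB t ht)
  -- The second Frenet equation forces this choice of torsion. The remaining components of `∇_T N`
  -- and `∇_T B` come from differentiating the orthonormality relations.
  refine ⟨fun t => inner ℝ (B t) (covDeriv γ N t), N, B, hN, hB, hTNB,
    fun t ht => by rw [hκ t ht]; exact hdT t ht, fun t ht => ?_, fun t ht => ?_⟩
  · obtain ⟨-, h2, -, -, -, -⟩ := hperp ht
    have e1 := HasDerivAt.unique_of_eqOn hJ ht (fun s hs => hTN s hs)
      ((hTat ht).hasDerivAt_inner (hNat ht)) (hasDerivAt_const t 0)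
    have e2 := HasDerivAt.unique_of_eqOn hJ ht (fun s hs => hNN s hs)
      ((hNat ht).hasDerivAt_inner (hNat ht)) (hasDerivAt_const t 1)
    rw [hdT t ht, real_inner_smul_left, h2] at e1
    rw [real_inner_comm] at e2
    have := Orthonormal.eq_sum_triple (finrank_tangentSpace hE (γ t)) (hTNB t ht) (covDeriv γ N t)
    rw [show inner ℝ (velocity γ t) (covDeriv γ N t) = -κ₀ by linarith,
      show inner ℝ (N t) (covDeriv γ N t) = 0 by linarith, zero_smul, add_zero] at this
    rw [hκ t ht]
    exact this
  · obtain ⟨-, -, -, -, -, h23⟩ := hperp ht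
    have e1 := HasDerivAt.unique_of_eqOn hJ ht (fun s hs => (hperp hs).2.2.2.2.1)
      ((hTat ht).hasDerivAt_inner (hBat ht)) (hasDerivAt_const t 0)
    have e2 := HasDerivAt.unique_of_eqOn hJ ht (fun s hs => (hperp hs).2.2.2.2.2)
      ((hNat ht).hasDerivAt_inner (hBat ht)) (hasDerivAt_const t 0)
    have e3 := HasDerivAt.unique_of_eqOn hJ ht (fun s hs => (hperp hs).2.2.1)
      ((hBat ht).hasDerivAt_inner (hBat ht)) (hasDerivAt_const t 1)
    rw [hdT t ht, real_inner_smul_left, h23] at e1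
    rw [real_inner_comm] at e2 e3
    have := Orthonormal.eq_sum_triple (finrank_tangentSpace hE (γ t)) (hTNB t ht) (covDeriv γ B t)
    rw [show inner ℝ (velocity γ t) (covDeriv γ B t) = 0 by linarith,
      show inner ℝ (N t) (covDeriv γ B t) = -inner ℝ (B t) (covDeriv γ N t) by linarith,
      show inner ℝ (B t) (covDeriv γ B t) = 0 by linarith, zero_smul, zero_smul, add_zero,
      zero_add] at this
    exact this

end FrameExistence

end TriharmonicCurve

end

theorem mainTheorem4 {M : Type*} [TopologicalSpace M]
    [ChartedSpace (EuclideanSpace ℝ (Fin 3)) M] [IsManifold (𝓡 3) ∞ M]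
    [Bundle.RiemannianBundle (fun x : M => TangentSpace (𝓡 3) x)]
    [IsContMDiffRiemannianBundle (𝓡 3) ∞ (EuclideanSpace ℝ (Fin 3))
      (fun x : M => TangentSpace (𝓡 3) x)]
    (J : Set ℝ) (hJ : IsOpen J) (hJ' : J.OrdConnected) (γ : ℝ → M)
    (htri : TriharmonicCurve.IsTriharmonic (EuclideanSpace ℝ (Fin 3)) γ J)
    (hproper : ¬ TriharmonicCurve.IsHarmonic (EuclideanSpace ℝ (Fin 3)) γ J)
    (κ₀ : ℝ)
    (hκ : ∀ t ∈ J, TriharmonicCurve.curvature (EuclideanSpace ℝ (Fin 3)) γ t = κ₀) :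
    κ₀ ≠ 0 ∧
    TriharmonicCurve.IsFrenetHelix (EuclideanSpace ℝ (Fin 3)) γ J ∧
    ∀ (τ : ℝ → ℝ) (N B : ∀ t, TangentSpace (𝓡 3) (γ t)),
      TriharmonicCurve.IsFrenetFrame γ J τ N B →
      ∃ τ₀ : ℝ, (∀ t ∈ J, τ t = τ₀) ∧
        ∀ t ∈ J,
          letI T : TangentSpace (𝓡 3) (γ t) := TriharmonicCurve.velocity γ t
          letI R := TriharmonicCurve.curvatureTensor (E := EuclideanSpace ℝ (Fin 3)) (γ t)
          (κ₀ ^ 2 + τ₀ ^ 2) ^ 2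
              - (2 * κ₀ ^ 2 + τ₀ ^ 2) * inner ℝ (R (N t) T T) (N t)
              - κ₀ * τ₀ * inner ℝ (R (B t) (N t) T) (N t) = 0 ∧
          (2 * κ₀ ^ 2 + τ₀ ^ 2) * inner ℝ (R (N t) T T) (B t)
              + κ₀ * τ₀ * inner ℝ (R (B t) (N t) T) (B t) = 0 := by

  have hκ₀ : κ₀ ≠ 0 := by
    rintro rfl
    exact hproper fun t ht => norm_eq_zero.1 (hκ t ht)
  -- On an empty `J` the curve would be vacuously harmonic. A base point is needed to glue the
  -- binormal.
  have hne : J.Nonempty := by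
    by_contra hne
    rw [Set.not_nonempty_iff_eq_empty] at hne
    exact hproper fun t ht => by simp [hne] at ht
  obtain ⟨t₀, ht₀⟩ := hne
  refine ⟨hκ₀, ?_, fun τ N B hF => ?_⟩
  · obtain ⟨τ, N, B, hF⟩ := TriharmonicCurve.exists_isFrenetFrame (by simp) hJ hJ' ht₀
      htri.arcLength hκ hκ₀
    obtain ⟨τ₀, hτ⟩ := htri.torsion_const hJ hJ' hκ hκ₀ hF
    exact ⟨κ₀, τ₀, N, B, hκ, hF.smooth_normal, hF.smooth_binormal, hF.orthonormal,
      hF.deriv_tangent, fun t ht => by rw [hF.deriv_normal t ht, hτ t ht],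
      fun t ht => by rw [hF.deriv_binormal t ht, hτ t ht]⟩
  · obtain ⟨τ₀, hτ⟩ := htri.torsion_const hJ hJ' hκ hκ₀ hF
    exact ⟨τ₀, hτ, fun t ht => htri.frenet_equations hJ hκ hκ₀ hF hτ ht⟩
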